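/- **Setting (univariate current status model).** Let $(X_i,T_i)$, $i\ge 1$, be i.i.d. pairs of real random variables with $X_i$ and $T_i$ independent. $X_i$ is concentrated on $[0,1]$ and has density $f\ge 0$ (with $f=0$ off $[0,1]$) and distribution function $F(v)=\int_{-\infty}^v f$; $T_i$ has density $q$, which vanishes off $[0,1]$ and is differentiable and strictly positive on $[0,1]$. One observes $T_i$ and $\Delta_i=1_{\{X_i\le T_i\}}$. Put $V_i=T_i+1$ if $\Delta_i=0$ and $V_i=T_i$ if $\Delta_i=1$, and $$g(v)=(q(v)+q(v-1))\,(F(v)-F(v-1)).$$ The kernel $w$ is a continuously differentiable symmetric probability density supported on $[-1,1]$. For $h>0$ let $$g_{nh}(x)=\frac1n\sum_{i=1}^n\frac1h w\Big(\frac{x-V_i}{h}\Big),\qquad g_{nh}'(x)=\frac1n\sum_{i=1}^n\frac1{h^2} w'\Big(\frac{x-V_i}{h}\Big),$$ $$f^-_{nh}(x)=\frac{g_{nh}'(x)}{q(x)}-\frac{q'(x)}{q(x)^2}g_{nh}(x),\qquad f^+_{nh}(x)=-\Big(\frac{g_{nh}'(x+1)}{q(x)}-\frac{q'(x)}{q(x)^2}g_{nh}(x+1)\Big),$$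 and $f^t_{nh}(x)=t f^-_{nh}(x)+(1-t)f^+_{nh}(x)$ for $0\le t\le 1$. Let $$b^-(x)=\frac{g'''(x)}{q(x)}-\frac{q'(x)}{q(x)^2}g''(x),\quad b^+(x)=-\frac{g'''(x+1)}{q(x)}+\frac{q'(x)}{q(x)^2}g''(x+1),\quad \sigma^2=\frac{F(x)(1-F(x))}{q(x)}\int w'(u)^2\,du .$$ **Theorem.** Let $0<x<1$, let $f$ be twice and $q$ three times continuously differentiable on a neighbourhood of $x$, and let $\hat F_n(x)$ be random variables (for instance estimators computed from the first $n$ observations), square integrable for all large $n$, with $\mathrm E(\hat F_n(x)-F(x))^2\to0$. Define $$f_{nh}(x)=(1-\hat F_n(x))f^-_{nh}(x)+\hat F_n(x)f^+_{nh}(x).$$ Let $h=h_n>0$ with $h=O(n^{-1/7})$. Then $h\to0$, and if $h$ is of exact order $n^{-1/7}$ (that is, also $n^{-1/7}=O(h)$) then $nh^3\to\infty$. Whenever $nh^3\to\infty$, the following hold as $n\to\infty$. 1. $\mathrm E f_{nh}(x)$ exists for all large $n$, and $\sqrt{nh^3}\,(f_{nh}(x)-\mathrm E f_{nh}(x))\to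 N(0,\sigma^2)$ in distribution (where $N(0,0)$ is the point mass at $0$). 2. If $\mathrm E(\hat F_n(x)-F(x))^2=o(nh^7)$, then $$\mathrm E f_{nh}(x)=f(x)+\tfrac12h^2\int v^2w(v)\,dv\,\big((1-F(x))b^-(x)+F(x)b^+(x)\big)+o(h^2).$$ 3. If $h=o(n^{-1/7})$, then $\sqrt{nh^3}\,(f_{nh}(x)-f(x))\to N(0,\sigma^2)$ in distribution, and $f_{nh}(x)$ is $t$-optimal: for every fixed $t\in[0,1]$ the estimator $f^t_{nh}(x)$ has an asymptotic mean squared error, and that of $f_{nh}(x)$ equals the minimum of these over $t\in[0,1]$. Here the asymptotic mean squared error of estimators $e_n$ of $f(x)$ is the second moment of the limit law of $\sqrt{nh^3}\,(e_n-f(x))$. If, in addition, $\hat F_n(x)$ has a finite fourth moment for all large $n$ and $\mathrm E(\hat F_n(x)-F(x))^4\to0$ (which is automatic if the $\hat F_n(x)$ are uniformly bounded), then $f_{nh}(x)$ is also $t$-optimal with the asymptotic mean squared error replaced by $\lim_n nh^3\,\mathrm E(e_n-f(x))^2$, and for $f_{nh}(x)$ this limit equals $\sigma^2$. -/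

import Mathlib

open MeasureTheory ProbabilityTheory Filter Topology Asymptotics

namespace CurrentStatus

noncomputable section

/-- Condition W: `w` is a continuously differentiable symmetric probability density
supported on `[-1, 1]`. -/
structure IsKernel (w : ℝ → ℝ) : Prop where
  contDiff : ContDiff ℝ 1 w
  symm : ∀ u, w (-u) = w u
  nonneg : ∀ u, 0 ≤ w u
  integral_eq_one : ∫ u, w u = 1
  support_subset : Function.support w ⊆ Set.Icc (-1) 1

/-- The univariate current status model. The pairs `(X i, T i)` are i.i.d., `X i` and `T i` are
independent, `X i` has density `f` and is concentrated on `[0, 1]`, and `T i` has density `q`,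
which vanishes off `[0, 1]` and is differentiable and strictly positive on `[0, 1]`. -/
structure Model {Ω : Type*} [MeasurableSpace Ω] (P : Measure Ω) (X T : ℕ → Ω → ℝ)
    (f q : ℝ → ℝ) : Prop where
  measurable_f : Measurable f
  f_nonneg : ∀ v, 0 ≤ f v
  f_eq_zero : ∀ v, v ∉ Set.Icc (0 : ℝ) 1 → f v = 0
  measurable_q : Measurable q
  q_pos : ∀ v ∈ Set.Icc (0 : ℝ) 1, 0 < q v
  q_eq_zero : ∀ v, v ∉ Set.Icc (0 : ℝ) 1 → q v = 0
  q_diff : DifferentiableOn ℝ q (Set.Icc 0 1)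
  measurable_X : ∀ i, Measurable (X i)
  measurable_T : ∀ i, Measurable (T i)
  law_X : ∀ i, P.map (X i) = volume.withDensity (fun v => ENNReal.ofReal (f v))
  law_T : ∀ i, P.map (T i) = volume.withDensity (fun v => ENNReal.ofReal (q v))
  indep_XT : ∀ i, IndepFun (X i) (T i) P
  indep_pairs : iIndepFun (fun i ω => (X i ω, T i ω)) P

/-- The distribution function with density `f`. -/
def distFun (f : ℝ → ℝ) (v : ℝ) : ℝ := ∫ u in Set.Iic v, f u

/-- The observed status `Δ = 1_{X ≤ T}`. -/
def status (X T : ℝ) : ℝ := if X ≤ T then 1 else 0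

/-- The transformed observation: `V = T + 1` if `Δ = 0` and `V = T` if `Δ = 1`. -/
def transformed (T Δ : ℝ) : ℝ := if Δ = 0 then T + 1 else T

/-- The transformed observations `V i` of the whole sample. -/
def obsV {Ω : Type*} (X T : ℕ → Ω → ℝ) (i : ℕ) (ω : Ω) : ℝ :=
  transformed (T i ω) (status (X i ω) (T i ω))

/-- The density of the transformed observations,
`g v = (q v + q (v - 1)) (F v - F (v - 1))`. -/
def densV (f q : ℝ → ℝ) (v : ℝ) : ℝ :=
  (q v + q (v - 1)) * (distFun f v - distFun f (v - 1))

/-- The kernel estimator `g_{nh}(x)` from observations `V 0, …, V (n-1)`. -/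
def kde (w : ℝ → ℝ) (n : ℕ) (h : ℝ) (V : ℕ → ℝ) (x : ℝ) : ℝ :=
  (1 / (n : ℝ)) * ∑ i ∈ Finset.range n, (1 / h) * w ((x - V i) / h)

/-- The derivative `g'_{nh}(x)` of the kernel estimator. -/
def kdeDeriv (w : ℝ → ℝ) (n : ℕ) (h : ℝ) (V : ℕ → ℝ) (x : ℝ) : ℝ :=
  (1 / (n : ℝ)) * ∑ i ∈ Finset.range n, (1 / h ^ 2) * deriv w ((x - V i) / h)

/-- The left estimator `f⁻_{nh}(x)`. -/
def fLeft (w q : ℝ → ℝ) (n : ℕ) (h : ℝ) (V : ℕ → ℝ) (x : ℝ) : ℝ :=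
  1 / q x * kdeDeriv w n h V x - deriv q x / q x ^ 2 * kde w n h V x

/-- The right estimator `f⁺_{nh}(x)`. -/
def fRight (w q : ℝ → ℝ) (n : ℕ) (h : ℝ) (V : ℕ → ℝ) (x : ℝ) : ℝ :=
  -(1 / q x * kdeDeriv w n h V (x + 1) - deriv q x / q x ^ 2 * kde w n h V (x + 1))

/-- The combined estimator `f^t_{nh}(x) = t f⁻_{nh}(x) + (1 - t) f⁺_{nh}(x)`. -/
def fComb (w q : ℝ → ℝ) (t : ℝ) (n : ℕ) (h : ℝ) (V : ℕ → ℝ) (x : ℝ) : ℝ :=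
  t * fLeft w q n h V x + (1 - t) * fRight w q n h V x

/-- The combined estimator with fixed weight `t`, as a sequence of random variables. -/
def combEst {Ω : Type*} (w q : ℝ → ℝ) (X T : ℕ → Ω → ℝ) (h : ℕ → ℝ) (x t : ℝ) (n : ℕ) (ω : Ω) :
    ℝ :=
  fComb w q t n (h n) (fun i => obsV X T i ω) x

/-- The final estimator
`f_{nh}(x) = (1 - F̂_n(x)) f⁻_{nh}(x) + F̂_n(x) f⁺_{nh}(x)`, where `Fhat n` is `F̂_n(x)`. -/
def finalEst {Ω : Type*} (w q : ℝ → ℝ) (X T : ℕ → Ω → ℝ) (Fhat : ℕ → Ω → ℝ) (h : ℕ → ℝ) (x : ℝ)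
    (n : ℕ) (ω : Ω) : ℝ :=
  (1 - Fhat n ω) * fLeft w q n (h n) (fun i => obsV X T i ω) x
    + Fhat n ω * fRight w q n (h n) (fun i => obsV X T i ω) x

/-- `b⁻(x) = g'''(x) / q(x) - q'(x) g''(x) / q(x)²`. -/
def bLeft (f q : ℝ → ℝ) (x : ℝ) : ℝ :=
  1 / q x * iteratedDeriv 3 (densV f q) x - deriv q x / q x ^ 2 * iteratedDeriv 2 (densV f q) x

/-- `b⁺(x) = -g'''(x+1) / q(x) + q'(x) g''(x+1) / q(x)²`. -/
def bRight (f q : ℝ → ℝ) (x : ℝ) : ℝ :=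
  -(1 / q x) * iteratedDeriv 3 (densV f q) (x + 1)
    + deriv q x / q x ^ 2 * iteratedDeriv 2 (densV f q) (x + 1)

/-- `σ² = F(x) (1 - F(x)) (1 / q(x)) ∫ w'(u)² du`. -/
def asympVar (w f q : ℝ → ℝ) (x : ℝ) : ℝ :=
  distFun f x * (1 - distFun f x) * (1 / q x) * ∫ u, deriv w u ^ 2

/-- The normalisation `√(n h³)`. -/
def rate (h : ℕ → ℝ) (n : ℕ) : ℝ := √((n : ℝ) * h n ^ 3)

/-- `Z n` converges in distribution to the normal law `N(0, s)` with variance `s ≥ 0`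
(the point mass at `0` if `s = 0`). -/
def TendstoNormal {Ω : Type*} [MeasurableSpace Ω] (P : Measure Ω) [IsProbabilityMeasure P]
    (Z : ℕ → Ω → ℝ) (s : ℝ) : Prop :=
  TendstoInDistribution Z atTop (id : ℝ → ℝ) (fun _ => P) (gaussianReal 0 s.toNNReal)

/-- The asymptotic mean squared error, at rate `r`, of the estimators `e n` of `θ` is `v`: the law
of `r n (e n - θ)` converges weakly to a law with finite second moment `v`. -/
def HasAsympMSE {Ω : Type*} [MeasurableSpace Ω] (P : Measure Ω) [IsProbabilityMeasure P]
    (r : ℕ → ℝ) (θ : ℝ) (e : ℕ → Ω → ℝ) (v : ℝ) : Prop :=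
  ∃ (ν : Measure ℝ) (_ : IsProbabilityMeasure ν),
    TendstoInDistribution (fun n ω => r n * (e n ω - θ)) atTop (id : ℝ → ℝ) (fun _ => P) ν ∧
    MemLp (id : ℝ → ℝ) 2 ν ∧ ∫ y, y ^ 2 ∂ν = v

/-- The limit of the mean squared error, at rate `r`, of the estimators `e n` of `θ` is `v`:
the `e n` are eventually square integrable and `(r n)² E (e n - θ)² → v`. -/
def HasLimitMSE {Ω : Type*} [MeasurableSpace Ω] (P : Measure Ω)
    (r : ℕ → ℝ) (θ : ℝ) (e : ℕ → Ω → ℝ) (v : ℝ) : Prop :=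
  (∀ᶠ n in atTop, MemLp (e n) 2 P) ∧
    Tendsto (fun n => r n ^ 2 * ∫ ω, (e n ω - θ) ^ 2 ∂P) atTop (𝓝 v)

/-- Optimality of an estimator `e` within a family `fam t`, `0 ≤ t ≤ 1`, with respect to an error
criterion (`crit e v` meaning that the error of `e` is `v`): every member of the family has an
error, and the error of `e` is the minimum of these over `t ∈ [0, 1]`. -/
def IsTOptimal {Ω : Type*} (crit : (ℕ → Ω → ℝ) → ℝ → Prop) (fam : ℝ → ℕ → Ω → ℝ)
    (e : ℕ → Ω → ℝ) : Prop :=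
  ∃ v, crit e v ∧ (∃ t ∈ Set.Icc (0 : ℝ) 1, crit (fam t) v) ∧
    ∀ t ∈ Set.Icc (0 : ℝ) 1, ∃ v', crit (fam t) v' ∧ v ≤ v'

end

end CurrentStatus

/-! The `V i` are i.i.d. with density `densV f q`, which equals `q F` near `x` and the shift by one
of `q (1 - F)` near `x + 1`. The product rule therefore recovers `f x` from the density and its
derivative at either point. So `f⁻` and `f⁺` both estimate `f x`, and every combination `a f⁻ + b
f⁺` (`linEst`) is an average of i.i.d. bounded terms.

For fixed weights, Taylor expansion and one integration by parts give the mean up to `o(h²)`. The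
kernel windows around `x` and `x + 1` are disjoint for small `h`, so the second moment has no cross
term, and the variance at rate `√(n h³)` tends to `combVar`, proportional to `a² F + b² (1 - F)`.
Each scaled summand is `O(h / rate)`, so a characteristic function argument (`tendstoNormal_rowSum`)
yields normality. On `a + b = 1` the variance factor exceeds `F (1 - F)` by a perfect square
vanishing at `a = 1 - F`, which is the optimality.

The random weight is handled by `finalEst_eq`: the final estimator is the combination with the ideal
weights plus `(F̂ - F)(f⁺ - f⁻)`. The contrast `f⁺ - f⁻` has target zero, hence mean `O(h²)`, and `h
= O(n^{-1/7})` keeps `√(n h³) h² = √(n h⁷)` bounded. The scaled contrast is thus bounded in `L²` and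
`L⁴` (`exists_integral_contrast_le`), and Cauchy–Schwarz makes the plug-in error negligible in `L¹`,
or in `L²` under fourth moments, whatever the dependence between `F̂` and the sample. -/

namespace CurrentStatus

/-! ### Sums of i.i.d. bounded variables: moments and a triangular central limit theorem. -/

section RowSums

variable {Ω : Type*} [MeasurableSpace Ω] {P : Measure Ω}
  {V : ℕ → Ω → ℝ} {ν : Measure ℝ}

lemma integrable_of_abs_le {α : Type*} [MeasurableSpace α] {μ : Measure α} [IsFiniteMeasure μ]
    {f : α → ℝ} (hf : Measurable f) {C : ℝ} (hC : ∀ a, |f a| ≤ C) : Integrable f μ :=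
  Integrable.of_bound hf.aestronglyMeasurable C (ae_of_all _ hC)

lemma measurable_rowSum (hV : ∀ i, Measurable (V i)) {ψ : ℝ → ℝ} (hψ : Measurable ψ) (n : ℕ) :
    Measurable fun ω => ∑ i ∈ Finset.range n, ψ (V i ω) :=
  Finset.measurable_fun_sum _ fun i _ => hψ.comp (hV i)

lemma abs_rowSum_le {Ω : Type*} {V : ℕ → Ω → ℝ} {ψ : ℝ → ℝ} {B : ℝ} (hB : ∀ v, |ψ v| ≤ B)
    (n : ℕ) (ω : Ω) : |∑ i ∈ Finset.range n, ψ (V i ω)| ≤ n * B := by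
  calc _ ≤ ∑ i ∈ Finset.range n, |ψ (V i ω)| := Finset.abs_sum_le_sum_abs _ _
    _ ≤ ∑ _i ∈ Finset.range n, B := Finset.sum_le_sum fun i _ => hB _
    _ = n * B := by simp

lemma indepFun_rowSum (hV : ∀ i, Measurable (V i)) (hind : iIndepFun V P)
    {ψ : ℝ → ℝ} (hψ : Measurable ψ) (n : ℕ) :
    IndepFun (fun ω => ∑ i ∈ Finset.range n, ψ (V i ω)) (fun ω => ψ (V n ω)) P := by
  have h1 : iIndepFun (fun i => ψ ∘ V i) P := hind.comp (fun _ => ψ) fun _ => hψ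
  have h2 := h1.indepFun_finsetSum_of_notMem (fun i => hψ.comp (hV i))
    (s := Finset.range n) (i := n) (by simp)
  convert h2 using 1
  · ext ω
    simp
  · rfl

lemma integral_comp_law (hV : ∀ i, Measurable (V i)) (hlaw : ∀ i, P.map (V i) = ν)
    {φ : ℝ → ℝ} (hφ : Measurable φ) (i : ℕ) : ∫ ω, φ (V i ω) ∂P = ∫ v, φ v ∂ν := by
  rw [← hlaw i, integral_map (hV i).aemeasurable hφ.aestronglyMeasurable]

lemma integral_rowSum [IsProbabilityMeasure P] (hV : ∀ i, Measurable (V i))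
    (hlaw : ∀ i, P.map (V i) = ν)
    {ψ : ℝ → ℝ} (hψ : Measurable ψ) {B : ℝ} (hB : ∀ v, |ψ v| ≤ B) (n : ℕ) :
    ∫ ω, ∑ i ∈ Finset.range n, ψ (V i ω) ∂P = n * ∫ v, ψ v ∂ν := by
  rw [integral_finsetSum _ fun i _ => integrable_of_abs_le
    (show Measurable fun ω => ψ (V i ω) from hψ.comp (hV i)) fun ω => hB _]
  simp [integral_comp_law hV hlaw hψ]

/-- Second and fourth moments of a sum of independent centred bounded variables. -/
lemma integral_rowSum_pow [IsProbabilityMeasure P] (hV : ∀ i, Measurable (V i))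
    (hind : iIndepFun V P)
    (hlaw : ∀ i, P.map (V i) = ν) {ψ : ℝ → ℝ} (hψ : Measurable ψ) {B : ℝ} (hB : ∀ v, |ψ v| ≤ B)
    (h0 : ∫ v, ψ v ∂ν = 0) (n : ℕ) :
    (∫ ω, (∑ i ∈ Finset.range n, ψ (V i ω)) ^ 2 ∂P = n * ∫ v, ψ v ^ 2 ∂ν) ∧
    (∫ ω, (∑ i ∈ Finset.range n, ψ (V i ω)) ^ 4 ∂P
      = n * ∫ v, ψ v ^ 4 ∂ν + 3 * (n * (n - 1)) * (∫ v, ψ v ^ 2 ∂ν) ^ 2) := by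
  induction n with
  | zero => simp
  | succ n ih =>
    set S : Ω → ℝ := fun ω => ∑ i ∈ Finset.range n, ψ (V i ω) with hS
    set Y : Ω → ℝ := fun ω => ψ (V n ω) with hY
    obtain ⟨ih2, ih4⟩ : (∫ ω, S ω ^ 2 ∂P = n * ∫ v, ψ v ^ 2 ∂ν) ∧ (∫ ω, S ω ^ 4 ∂P
      = n * ∫ v, ψ v ^ 4 ∂ν + 3 * (n * (n - 1)) * (∫ v, ψ v ^ 2 ∂ν) ^ 2) := ih
    have hSm : Measurable S := measurable_rowSum hV hψ n
    have hYm : Measurable Y := hψ.comp (hV n)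
    have hSY : IndepFun S Y P := indepFun_rowSum hV hind hψ n
    have hprod (j k : ℕ) : ∫ ω, S ω ^ j * Y ω ^ k ∂P = (∫ ω, S ω ^ j ∂P) * ∫ ω, Y ω ^ k ∂P :=
      IndepFun.integral_fun_mul_eq_mul_integral
        (hSY.comp (measurable_id.pow_const j) (measurable_id.pow_const k))
        (hSm.pow_const j).aestronglyMeasurable (hYm.pow_const k).aestronglyMeasurable
    have hint (j k : ℕ) : Integrable (fun ω => S ω ^ j * Y ω ^ k) P := by
      refine integrable_of_abs_le ((hSm.pow_const j).mul (hYm.pow_const k))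
        (C := (n * B) ^ j * B ^ k) fun ω => ?_
      rw [abs_mul, abs_pow, abs_pow]
      have h1 : |S ω| ≤ n * B := abs_rowSum_le hB n ω
      have h2 : |Y ω| ≤ B := hB _
      have h3 : 0 ≤ n * B := (abs_nonneg _).trans h1
      gcongr
    have hYlaw (k : ℕ) : ∫ ω, Y ω ^ k ∂P = ∫ v, ψ v ^ k ∂ν :=
      integral_comp_law hV hlaw (hψ.pow_const k) n
    have hS1 : ∫ ω, S ω ∂P = 0 := by rw [integral_rowSum hV hlaw hψ hB, h0, mul_zero]
    have hY1 : ∫ ω, Y ω ∂P = 0 := by rw [← h0]; simpa using hYlaw 1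
    have hstep (ω : Ω) : ∑ i ∈ Finset.range (n + 1), ψ (V i ω) = S ω + Y ω :=
      Finset.sum_range_succ _ _
    simp only [hstep]
    constructor
    -- The zeroth powers are kept so that every term has the shape `S ^ j * Y ^ k` treated by
    -- `hprod` and `hint`.
    · have : ∀ ω, (S ω + Y ω) ^ 2
          = S ω ^ 2 * Y ω ^ 0 + 2 * (S ω ^ 1 * Y ω ^ 1) + S ω ^ 0 * Y ω ^ 2 := fun ω => by ring
      simp only [this]
      rw [integral_add ((hint 2 0).fun_add ((hint 1 1).const_mul 2)) (hint 0 2),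
        integral_add (hint 2 0) ((hint 1 1).const_mul 2), integral_const_mul]
      simp only [hprod]
      simp only [pow_one, hS1, hYlaw 2, ih2]
      simp
      ring
    -- Centring kills the terms in `S³ Y` and `S Y³`. The term `6 S² Y²` contributes `6 n m₂²`,
    -- which is the increment of `3 n (n - 1) m₂²`, where `m₂` is the second moment of `ψ`.
    · have : ∀ ω, (S ω + Y ω) ^ 4 = S ω ^ 4 * Y ω ^ 0 + 4 * (S ω ^ 3 * Y ω ^ 1)
          + 6 * (S ω ^ 2 * Y ω ^ 2) + 4 * (S ω ^ 1 * Y ω ^ 3) + S ω ^ 0 * Y ω ^ 4 :=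
        fun ω => by ring
      simp only [this]
      rw [integral_add ((((hint 4 0).fun_add ((hint 3 1).const_mul 4)).fun_add
            ((hint 2 2).const_mul 6)).fun_add ((hint 1 3).const_mul 4)) (hint 0 4),
        integral_add (((hint 4 0).fun_add ((hint 3 1).const_mul 4)).fun_add
            ((hint 2 2).const_mul 6)) ((hint 1 3).const_mul 4),
        integral_add ((hint 4 0).fun_add ((hint 3 1).const_mul 4)) ((hint 2 2).const_mul 6),
        integral_add (hint 4 0) ((hint 3 1).const_mul 4)]
      simp only [integral_const_mul]
      simp only [hprod]
      simp only [pow_one, hS1, hY1, hYlaw 2, hYlaw 4, ih2, ih4]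
      simp
      ring

/-- The exponential is expanded to second order with remainder `|z|³ exp |z|`, and the linear term
integrates to zero. One factor `|ψ|` of the cube is traded for `B`, so the error is `B` times a
second moment and survives multiplication by `n` in a triangular array. -/
lemma norm_charFun_law_sub_le [IsProbabilityMeasure ν] {ψ : ℝ → ℝ} (hψ : Measurable ψ) {B : ℝ}
    (hB : ∀ v, |ψ v| ≤ B) (h0 : ∫ v, ψ v ∂ν = 0) (t : ℝ) :
    ‖charFun (ν.map ψ) t - (1 - ((t ^ 2 / 2 * ∫ v, ψ v ^ 2 ∂ν : ℝ) : ℂ))‖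
      ≤ |t| ^ 3 * Real.exp (|t| * B) * B * ∫ v, ψ v ^ 2 ∂ν := by
  have hi1 : Integrable ψ ν := integrable_of_abs_le hψ hB
  have hi2 : Integrable (fun v => ψ v ^ 2) ν :=
    integrable_of_abs_le (hψ.pow_const 2) (C := B ^ 2) fun v => by
      rw [abs_pow]; have := hB v; gcongr
  have hmeas : Measurable fun v => Complex.exp (t * ψ v * Complex.I) := by fun_prop
  have hie : Integrable (fun v => Complex.exp (t * ψ v * Complex.I)) ν := by
    refine Integrable.of_bound hmeas.aestronglyMeasurable 1 (ae_of_all _ fun v => ?_)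
    rw [← Complex.ofReal_mul, Complex.norm_exp_ofReal_mul_I]
  have hchar : charFun (ν.map ψ) t = ∫ v, Complex.exp (t * ψ v * Complex.I) ∂ν := by
    rw [charFun_apply_real, integral_map hψ.aemeasurable (by fun_prop)]
  have hquad : ∫ v, (1 + ((t * ψ v : ℝ) : ℂ) * Complex.I - ((t ^ 2 / 2 * ψ v ^ 2 : ℝ) : ℂ)) ∂ν
      = 1 - ((t ^ 2 / 2 * ∫ v, ψ v ^ 2 ∂ν : ℝ) : ℂ) := by
    have j1 : Integrable (fun v => ((t * ψ v : ℝ) : ℂ) * Complex.I) ν :=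
      ((hi1.const_mul t).ofReal).mul_const _
    have j2 : Integrable (fun v => ((t ^ 2 / 2 * ψ v ^ 2 : ℝ) : ℂ)) ν :=
      (hi2.const_mul _).ofReal
    rw [integral_sub ((integrable_const 1).fun_add j1) j2, integral_add (integrable_const 1) j1,
      integral_mul_const, integral_complex_ofReal, integral_complex_ofReal, integral_const_mul,
      integral_const_mul, h0]
    simp
  have hiq : Integrable
      (fun v => (1 + ((t * ψ v : ℝ) : ℂ) * Complex.I - ((t ^ 2 / 2 * ψ v ^ 2 : ℝ) : ℂ))) ν :=
    ((integrable_const 1).add (((hi1.const_mul t).ofReal).mul_const _)).sub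
      (hi2.const_mul _).ofReal
  rw [hchar, ← hquad, ← integral_sub hie hiq, ← integral_const_mul]
  refine norm_integral_le_of_norm_le (hi2.const_mul _) (ae_of_all _ fun v => ?_)
  have h3 := Complex.norm_exp_sub_sum_le_norm_mul_exp (t * ψ v * Complex.I) 3
  have hsum : ∑ m ∈ Finset.range 3, ((t : ℂ) * ψ v * Complex.I) ^ m / (m.factorial : ℂ)
      = 1 + ((t * ψ v : ℝ) : ℂ) * Complex.I - ((t ^ 2 / 2 * ψ v ^ 2 : ℝ) : ℂ) := by
    simp only [Finset.sum_range_succ, Finset.range_zero, Finset.sum_empty, Nat.factorial]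
    push_cast
    rw [mul_pow _ Complex.I 2, Complex.I_sq]
    ring
  rw [hsum] at h3
  refine h3.trans ?_
  have hn : ‖(t : ℂ) * ψ v * Complex.I‖ = |t| * |ψ v| := by simp
  rw [hn]
  have hb := hB v
  have hB0 : 0 ≤ B := (abs_nonneg _).trans hb
  calc (|t| * |ψ v|) ^ 3 * Real.exp (|t| * |ψ v|)
      = |t| ^ 3 * Real.exp (|t| * |ψ v|) * |ψ v| * ψ v ^ 2 := by rw [← sq_abs (ψ v)]; ring
    _ ≤ |t| ^ 3 * Real.exp (|t| * B) * B * ψ v ^ 2 := by gcongr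

/-- Central limit theorem for triangular arrays with uniformly small, rowwise i.i.d. entries. -/
theorem tendstoNormal_rowSum [IsProbabilityMeasure P] [IsProbabilityMeasure ν]
    (hV : ∀ i, Measurable (V i))
    (hind : iIndepFun V P) (hlaw : ∀ i, P.map (V i) = ν) {ψ : ℕ → ℝ → ℝ}
    (hψ : ∀ n, Measurable (ψ n)) {B : ℕ → ℝ} (hB : ∀ᶠ n in atTop, ∀ v, |ψ n v| ≤ B n)
    (hB0 : Tendsto B atTop (𝓝 0)) (h0 : ∀ᶠ n in atTop, ∫ v, ψ n v ∂ν = 0) {τ : ℝ}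
    (hτ : Tendsto (fun n : ℕ => n * ∫ v, ψ n v ^ 2 ∂ν) atTop (𝓝 τ)) :
    TendstoNormal P (fun n ω => ∑ i ∈ Finset.range n, ψ n (V i ω)) τ := by
  -- Nonnegativity ensures that `τ.toNNReal` does not truncate.
  have hτ0 : 0 ≤ τ := ge_of_tendsto' hτ fun n =>
    mul_nonneg n.cast_nonneg (integral_nonneg fun v => sq_nonneg _)
  refine ⟨fun n => (measurable_rowSum hV (hψ n) n).aemeasurable, aemeasurable_id, ?_⟩
  refine ProbabilityMeasure.tendsto_iff_tendsto_charFun.2 fun t => ?_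
  have hpow (n : ℕ) : charFun (P.map fun ω => ∑ i ∈ Finset.range n, ψ n (V i ω)) t
      = charFun (ν.map (ψ n)) t ^ n := by
    have h1 : iIndepFun (fun i => ψ n ∘ V i) P := hind.comp (fun _ => ψ n) fun _ => hψ n
    have h2 := (h1.restrict (Finset.range n)).charFun_map_fun_finsetSum_eq_prod
      fun i _ => ((hψ n).comp (hV i)).aemeasurable
    simp only [Function.comp_apply] at h2
    rw [h2, Finset.prod_apply]
    have h3 (i : ℕ) : P.map (ψ n ∘ V i) = ν.map (ψ n) := by
      rw [← hlaw i, Measure.map_map (hψ n) (hV i)]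
    simp [h3]
  simp only [ProbabilityMeasure.coe_mk, hpow, Measure.map_id, charFun_gaussianReal,
    Real.coe_toNNReal τ hτ0]
  -- It is enough that `n (φₙ(t) - 1)` converges, `φₙ` being the characteristic function of one
  -- entry, because `(1 + zₙ / n)ⁿ → exp z` when `zₙ → z`.
  have key : Tendsto (fun n : ℕ => (n : ℂ) * (charFun (ν.map (ψ n)) t - 1)) atTop
      (𝓝 (-(((t ^ 2 / 2 * τ : ℝ)) : ℂ))) := by
    have hmain : Tendsto (fun n : ℕ =>
        (-((t ^ 2 / 2 * (n * ∫ v, ψ n v ^ 2 ∂ν) : ℝ) : ℂ))) atTop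
        (𝓝 (-(((t ^ 2 / 2 * τ : ℝ)) : ℂ))) :=
      ((Complex.continuous_ofReal.tendsto _).comp (hτ.const_mul (t ^ 2 / 2))).neg
    have herr : Tendsto (fun n : ℕ => (n : ℂ) * (charFun (ν.map (ψ n)) t
        - (1 - ((t ^ 2 / 2 * ∫ v, ψ n v ^ 2 ∂ν : ℝ) : ℂ)))) atTop (𝓝 0) := by
      have hb : Tendsto (fun n : ℕ => |t| ^ 3 * Real.exp (|t| * B n) * B n
          * (n * ∫ v, ψ n v ^ 2 ∂ν)) atTop (𝓝 0) := by
        have e1 : Tendsto (fun n => Real.exp (|t| * B n)) atTop (𝓝 (Real.exp (|t| * 0))) :=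
          (Real.continuous_exp.tendsto _).comp (hB0.const_mul _)
        simpa using ((e1.const_mul (|t| ^ 3)).mul hB0).mul hτ
      refine squeeze_zero_norm' ?_ hb
      filter_upwards [hB, h0] with n hBn h0n
      rw [norm_mul, Complex.norm_natCast]
      calc _ ≤ (n : ℝ) * (|t| ^ 3 * Real.exp (|t| * B n) * B n * ∫ v, ψ n v ^ 2 ∂ν) := by
            gcongr
            exact norm_charFun_law_sub_le (hψ n) hBn h0n t
        _ = _ := by ring
    have := hmain.add herr
    rw [add_zero] at this
    refine this.congr fun n => ?_
    push_cast
    ring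
  have := Complex.tendsto_one_add_pow_exp_of_tendsto key
  simp only [add_sub_cancel] at this
  convert this using 3
  push_cast
  ring

end RowSums

/-! ### Kernel smoothing of locally regular functions. -/

section Smoothing

/-- Converts a property near `y` into one holding on the whole smoothing window. The range `[-2, 2]`
is wider than the kernel support, to leave room for integration by parts with vanishing boundary
terms. -/
lemma eventually_forall_shift {p : ℝ → Prop} {y : ℝ} (hp : ∀ᶠ s in 𝓝 y, p s) :
    ∀ᶠ h in 𝓝[>] (0 : ℝ), ∀ u ∈ Set.Icc (-2 : ℝ) 2, p (y - h * u) := by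
  obtain ⟨δ, hδ, hball⟩ := Metric.eventually_nhds_iff.1 hp
  filter_upwards [Ioo_mem_nhdsGT (half_pos hδ)] with h hh u hu
  apply hball
  have h2 : |u| ≤ 2 := abs_le.2 hu
  rw [Real.dist_eq, sub_sub_cancel_left, abs_neg, abs_mul, abs_of_pos hh.1]
  nlinarith [hh.1, hh.2, abs_nonneg u]

lemma Icc_subset_Icc_two : Set.Icc (-1 : ℝ) 1 ⊆ Set.Icc (-2) 2 :=
  Set.Icc_subset_Icc (by norm_num) (by norm_num)

lemma hasCompactSupport_of_support_subset {κ : ℝ → ℝ}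
    (hs : Function.support κ ⊆ Set.Icc (-1) 1) : HasCompactSupport κ :=
  HasCompactSupport.intro isCompact_Icc fun _ hu => by_contra fun h => hu (hs h)

lemma integrable_kernel_mul {κ G : ℝ → ℝ} (hκ : Continuous κ)
    (hs : Function.support κ ⊆ Set.Icc (-1) 1) {y h : ℝ}
    (hG : ∀ u ∈ Set.Icc (-2 : ℝ) 2, ContinuousAt G (y - h * u)) :
    Integrable fun u => κ u * G (y - h * u) := by
  rw [← integrableOn_iff_integrable_of_support_subset (s := Set.Icc (-1) 1)]
  · refine ContinuousOn.integrableOn_Icc fun u hu => ContinuousAt.continuousWithinAt ?_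
    exact hκ.continuousAt.mul
      (ContinuousAt.comp (f := fun u => y - h * u) (hG u (Icc_subset_Icc_two hu)) (by fun_prop))
  · exact (Function.support_mul_subset_left _ _).trans hs

/-- Dominated convergence: on the support of `κ` and for small `h` only values of `G` near `y`
enter, and these are below `|G y| + 1`. No global regularity of `G` is needed. -/
lemma tendsto_integral_kernel_mul {κ G : ℝ → ℝ} (hκ : Continuous κ)
    (hs : Function.support κ ⊆ Set.Icc (-1) 1) {y : ℝ} (hG : ∀ᶠ s in 𝓝 y, ContinuousAt G s) :
    Tendsto (fun h => ∫ u, κ u * G (y - h * u)) (𝓝[>] 0) (𝓝 (G y * ∫ u, κ u)) := by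
  have hGy : ContinuousAt G y := hG.self_of_nhds
  have hlim : G y * ∫ u, κ u = ∫ u, κ u * G y := by rw [integral_mul_const, mul_comm]
  rw [hlim]
  refine tendsto_integral_filter_of_dominated_convergence (fun u => ‖κ u‖ * (|G y| + 1)) ?_ ?_ ?_ ?_
  · filter_upwards [eventually_forall_shift hG] with h hh
    exact (integrable_kernel_mul hκ hs hh).aestronglyMeasurable
  · have hb : ∀ᶠ s in 𝓝 y, |G s| < |G y| + 1 :=
      hGy.abs.eventually_lt_const (lt_add_one _)
    filter_upwards [eventually_forall_shift hb] with h hh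
    refine ae_of_all _ fun u => ?_
    by_cases hu : u ∈ Set.Icc (-1 : ℝ) 1
    · rw [norm_mul]
      exact mul_le_mul_of_nonneg_left (hh u (Icc_subset_Icc_two hu)).le (norm_nonneg _)
    · have : κ u = 0 := by_contra fun h => hu (hs h)
      simp [this]
  · exact ((hκ.integrable_of_hasCompactSupport
      (hasCompactSupport_of_support_subset hs)).norm).mul_const _
  · refine ae_of_all _ fun u => ?_
    have h1 : Tendsto (fun h : ℝ => y - h * u) (𝓝[>] 0) (𝓝 y) := by
      have : Tendsto (fun h : ℝ => y - h * u) (𝓝 0) (𝓝 (y - 0 * u)) :=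
        Continuous.tendsto (by fun_prop) 0
      rw [zero_mul, sub_zero] at this
      exact this.mono_left nhdsWithin_le_nhds
    exact (hGy.tendsto.comp h1).const_mul _

lemma eventually_continuousAt_of_contDiffAt {G : ℝ → ℝ} {y : ℝ} {n : ℕ}
    (hG : ContDiffAt ℝ n G y) : ∀ᶠ s in 𝓝 y, ContinuousAt G s :=
  (hG.eventually (by simp)).mono fun _ h => h.continuousAt

/-- Second order Taylor expansion at a point, with little-o remainder. -/
lemma isLittleO_taylor_two {G : ℝ → ℝ} {y : ℝ} (hG : ContDiffAt ℝ 2 G y) :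
    (fun s => G s - (G y + deriv G y * (s - y) + iteratedDeriv 2 G y / 2 * (s - y) ^ 2))
      =o[𝓝 y] fun s => (s - y) ^ 2 := by
  obtain ⟨δ, hδ, hball⟩ := Metric.eventually_nhds_iff_ball.1 (hG.eventually (by simp))
  have hy : y ∈ Metric.ball y δ := Metric.mem_ball_self hδ
  have h := taylor_isLittleO (n := 2) (convex_ball y δ) hy
    fun s hs => (hball s hs).contDiffWithinAt
  rw [Metric.isOpen_ball.nhdsWithin_eq hy] at h
  refine h.congr_left fun s => ?_
  have h2 : iteratedDerivWithin 2 G (Metric.ball y δ) y = iteratedDeriv 2 G y :=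
    iteratedDerivWithin_of_isOpen Metric.isOpen_ball hy
  have h1 : iteratedDerivWithin 1 G (Metric.ball y δ) y = deriv G y := by
    rw [iteratedDerivWithin_of_isOpen Metric.isOpen_ball hy, iteratedDeriv_one]
  rw [taylor_within_apply]
  simp only [Finset.sum_range_succ, Finset.range_zero, Finset.sum_empty, h1, h2,
    iteratedDerivWithin_zero, smul_eq_mul, Nat.factorial]
  push_cast
  ring

variable {w : ℝ → ℝ}

lemma IsKernel.continuous (hw : IsKernel w) : Continuous w := hw.contDiff.continuous

lemma IsKernel.continuous_deriv (hw : IsKernel w) : Continuous (deriv w) :=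
  hw.contDiff.continuous_deriv le_rfl

lemma IsKernel.support_deriv_subset (hw : IsKernel w) :
    Function.support (deriv w) ⊆ Set.Icc (-1) 1 :=
  _root_.support_deriv_subset.trans (closure_minimal hw.support_subset isClosed_Icc)

/-- The integrand is odd. This removes the first-order term from the bias. -/
lemma IsKernel.integral_mul_self_eq_zero (hw : IsKernel w) : ∫ u, w u * u = 0 := by
  have h := integral_neg_eq_self (fun u => w u * u) volume
  simp only [hw.symm, mul_neg, integral_neg] at h
  linarith

/-- Bias of a kernel smoother to second order. -/
lemma IsKernel.isLittleO_integral_mul (hw : IsKernel w) {G : ℝ → ℝ} {y : ℝ}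
    (hG : ContDiffAt ℝ 2 G y) :
    (fun h => (∫ u, w u * G (y - h * u))
      - (G y + 1 / 2 * h ^ 2 * (∫ v, v ^ 2 * w v) * iteratedDeriv 2 G y))
      =o[𝓝[>] 0] fun h => h ^ 2 := by
  have hcs := hasCompactSupport_of_support_subset hw.support_subset
  have hi0 : Integrable w := hw.continuous.integrable_of_hasCompactSupport hcs
  have hi1 : Integrable fun u => w u * u :=
    (hw.continuous.mul continuous_id).integrable_of_hasCompactSupport hcs.mul_right
  have hi2 : Integrable fun u => u ^ 2 * w u :=
    ((continuous_id.pow 2).mul hw.continuous).integrable_of_hasCompactSupport hcs.mul_left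
  refine isLittleO_iff.2 fun c hc => ?_
  have hT := isLittleO_iff.1 (isLittleO_taylor_two hG) hc
  filter_upwards [eventually_forall_shift hT,
    eventually_forall_shift (eventually_continuousAt_of_contDiffAt (n := 2) hG)] with h hh hcont
  have hiG := integrable_kernel_mul hw.continuous hw.support_subset hcont
  -- The kernel moments `1`, `0` and `∫ v² w` reproduce the Taylor polynomial exactly, so only its
  -- remainder is left under the integral.
  have heq : (∫ u, w u * G (y - h * u))
      - (G y + 1 / 2 * h ^ 2 * (∫ v, v ^ 2 * w v) * iteratedDeriv 2 G y)
      = ∫ u, w u * (G (y - h * u) - (G y + deriv G y * ((y - h * u) - y)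
          + iteratedDeriv 2 G y / 2 * ((y - h * u) - y) ^ 2)) := by
    have : ∀ u, w u * (G (y - h * u) - (G y + deriv G y * ((y - h * u) - y)
          + iteratedDeriv 2 G y / 2 * ((y - h * u) - y) ^ 2))
        = w u * G (y - h * u) - (G y * w u + (-(deriv G y * h)) * (w u * u)
          + (iteratedDeriv 2 G y / 2 * h ^ 2) * (u ^ 2 * w u)) := fun u => by ring
    simp only [this]
    rw [integral_sub hiG (((hi0.const_mul _).fun_add (hi1.const_mul _)).fun_add (hi2.const_mul _)),
      integral_add ((hi0.const_mul _).fun_add (hi1.const_mul _)) (hi2.const_mul _),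
      integral_add (hi0.const_mul _) (hi1.const_mul _)]
    simp only [integral_const_mul, hw.integral_eq_one, hw.integral_mul_self_eq_zero]
    ring
  rw [heq]
  have hbound : ∀ u, ‖w u * (G (y - h * u) - (G y + deriv G y * ((y - h * u) - y)
          + iteratedDeriv 2 G y / 2 * ((y - h * u) - y) ^ 2))‖ ≤ c * ‖h ^ 2‖ * w u := by
    intro u
    by_cases hu : u ∈ Set.Icc (-1 : ℝ) 1
    · rw [norm_mul, Real.norm_of_nonneg (hw.nonneg u), mul_comm]
      refine mul_le_mul_of_nonneg_right ?_ (hw.nonneg u)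
      refine (hh u (Icc_subset_Icc_two hu)).trans ?_
      refine mul_le_mul_of_nonneg_left ?_ hc.le
      have h1 : u ^ 2 ≤ 1 := by rw [sq_le_one_iff_abs_le_one]; exact abs_le.2 hu
      rw [sub_sub_cancel_left, neg_sq, mul_pow, norm_mul]
      refine mul_le_of_le_one_right (norm_nonneg _) ?_
      rwa [Real.norm_of_nonneg (sq_nonneg u)]
    · have : w u = 0 := by_contra fun h => hu (hw.support_subset h)
      simp [this]
  refine (norm_integral_le_of_norm_le (hi0.const_mul _) (ae_of_all _ hbound)).trans ?_
  rw [integral_const_mul, hw.integral_eq_one, mul_one]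

/-- Integration by parts against the derivative of the kernel. -/
lemma IsKernel.eventually_integral_deriv_mul (hw : IsKernel w) {G : ℝ → ℝ} {y : ℝ}
    (hG : ContDiffAt ℝ 1 G y) :
    ∀ᶠ h in 𝓝[>] 0, ∫ u, deriv w u * G (y - h * u) = h * ∫ u, w u * deriv G (y - h * u) := by
  have hG1 : ∀ᶠ s in 𝓝 y, ContDiffAt ℝ 1 G s := hG.eventually (by simp)
  filter_upwards [eventually_forall_shift hG1] with h hh
  -- The larger interval makes `w` vanish at both end points, and contains `-1`, which the half-open
  -- interval `Ioc (-1) 1` would miss.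
  have hsub : Set.Icc (-1 : ℝ) 1 ⊆ Set.Ioc (-2) 2 := fun u hu =>
    ⟨by linarith [hu.1], by linarith [hu.2]⟩
  have hw2 : ∀ u : ℝ, u ∉ Set.Icc (-1 : ℝ) 1 → w u = 0 := fun u hu =>
    by_contra fun h => hu (hw.support_subset h)
  rw [← integral_const_mul]
  rw [← intervalIntegral.integral_eq_integral_of_support_subset (a := -2) (b := 2)
      (((Function.support_mul_subset_left _ _).trans hw.support_deriv_subset).trans hsub),
    ← intervalIntegral.integral_eq_integral_of_support_subset (a := -2) (b := 2)
      ((Function.support_mul_subset_right _ _).trans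
        ((Function.support_mul_subset_left _ _).trans (hw.support_subset.trans hsub)))]
  have hu2 : Set.uIcc (-2 : ℝ) 2 = Set.Icc (-2) 2 := Set.uIcc_of_le (by norm_num)
  have hcomp : ∀ u ∈ Set.uIcc (-2 : ℝ) 2,
      HasDerivAt (fun u => G (y - h * u)) (deriv G (y - h * u) * (-h)) u := by
    intro u hu
    rw [hu2] at hu
    have h1 : HasDerivAt G (deriv G (y - h * u)) (y - h * u) :=
      ((hh u hu).differentiableAt (by simp)).hasDerivAt
    have h2 : HasDerivAt (fun u : ℝ => y - h * u) (-h) u := by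
      simpa using ((hasDerivAt_id u).const_mul h).const_sub y
    exact h1.comp u h2
  have hd : ContinuousOn (fun u => deriv G (y - h * u) * (-h)) (Set.uIcc (-2 : ℝ) 2) := by
    intro u hu
    rw [hu2] at hu
    refine ContinuousAt.continuousWithinAt (ContinuousAt.mul ?_ continuousAt_const)
    have h1 : ContinuousAt (deriv G) (y - h * u) :=
      ((hh u hu).derivWithin (m := 0) (by simp)).continuousAt
    exact ContinuousAt.comp (f := fun u => y - h * u) h1 (by fun_prop)
  have hparts := intervalIntegral.integral_mul_deriv_eq_deriv_mul (a := -2) (b := 2)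
    (fun u _ => (hw.contDiff.differentiable (by simp) u).hasDerivAt) hcomp
    (hw.continuous_deriv.intervalIntegrable _ _) hd.intervalIntegrable
  rw [hw2 2 (by norm_num), hw2 (-2) (by norm_num)] at hparts
  have : ∀ u, h * (w u * deriv G (y - h * u)) = -(w u * (deriv G (y - h * u) * -h)) :=
    fun u => by ring
  simp only [this]
  rw [intervalIntegral.integral_neg, hparts]
  ring

end Smoothing

/-! ### The law of the transformed observations. -/

section Law

variable {Ω : Type*} [MeasurableSpace Ω] {P : Measure Ω} {X T : ℕ → Ω → ℝ} {f q : ℝ → ℝ}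

lemma transformed_status (x t : ℝ) : transformed t (status x t) = if x ≤ t then t else t + 1 := by
  by_cases h : x ≤ t <;> simp [transformed, status, h]

lemma measurable_transformed_status :
    Measurable fun p : ℝ × ℝ => transformed p.2 (status p.1 p.2) := by
  simp only [transformed_status]
  exact Measurable.ite (measurableSet_le measurable_fst measurable_snd) measurable_snd
    (measurable_snd.add_const 1)

lemma Model.measurable_obsV (hM : Model P X T f q) (i : ℕ) : Measurable (obsV X T i) :=
  measurable_transformed_status.comp ((hM.measurable_X i).prodMk (hM.measurable_T i))

lemma Model.iIndepFun_obsV (hM : Model P X T f q) : iIndepFun (obsV X T) P :=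
  hM.indep_pairs.comp (fun _ p => transformed p.2 (status p.1 p.2))
    fun _ => measurable_transformed_status

lemma Model.map_pair [IsProbabilityMeasure P] (hM : Model P X T f q) (i : ℕ) :
    P.map (fun ω => (X i ω, T i ω)) = (P.map (X i)).prod (P.map (T i)) :=
  (indepFun_iff_map_prod_eq_prod_map_map (hM.measurable_X i).aemeasurable
    (hM.measurable_T i).aemeasurable).1 (hM.indep_XT i)

/-- By independence the law of the pair is the product of its marginals, and these do not depend on
`i`. -/
lemma Model.map_obsV [IsProbabilityMeasure P] (hM : Model P X T f q) (i : ℕ) :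
    P.map (obsV X T i) = P.map (obsV X T 0) := by
  have h (j : ℕ) : P.map (obsV X T j) = ((P.map (X j)).prod (P.map (T j))).map
      fun p => transformed p.2 (status p.1 p.2) := by
    rw [← hM.map_pair j, Measure.map_map measurable_transformed_status
      ((hM.measurable_X j).prodMk (hM.measurable_T j))]
    rfl
  rw [h i, h 0, hM.law_X i, hM.law_X 0, hM.law_T i, hM.law_T 0]

lemma Model.lintegral_f [IsProbabilityMeasure P] (hM : Model P X T f q) :
    ∫⁻ v, ENNReal.ofReal (f v) = 1 := by
  have h := congrArg (fun μ => μ Set.univ) (hM.law_X 0)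
  simp only [withDensity_apply _ MeasurableSet.univ, Measure.restrict_univ] at h
  have := Measure.isProbabilityMeasure_map (μ := P) (hM.measurable_X 0).aemeasurable
  rw [← h, measure_univ]

lemma Model.integrable_f [IsProbabilityMeasure P] (hM : Model P X T f q) : Integrable f := by
  refine ⟨hM.measurable_f.aestronglyMeasurable, ?_⟩
  rw [hasFiniteIntegral_iff_ofReal (ae_of_all _ hM.f_nonneg), hM.lintegral_f]
  exact ENNReal.one_lt_top

lemma Model.q_nonneg (hM : Model P X T f q) (v : ℝ) : 0 ≤ q v := by
  by_cases h : v ∈ Set.Icc (0 : ℝ) 1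
  · exact (hM.q_pos v h).le
  · exact (hM.q_eq_zero v h).ge

lemma Model.integrable_q [IsProbabilityMeasure P] (hM : Model P X T f q) : Integrable q := by
  refine ⟨hM.measurable_q.aestronglyMeasurable, ?_⟩
  have h := congrArg (fun μ => μ Set.univ) (hM.law_T 0)
  simp only [withDensity_apply _ MeasurableSet.univ, Measure.restrict_univ] at h
  have := Measure.isProbabilityMeasure_map (μ := P) (hM.measurable_T 0).aemeasurable
  rw [hasFiniteIntegral_iff_ofReal (ae_of_all _ hM.q_nonneg), ← h, measure_univ]
  exact ENNReal.one_lt_top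

lemma Model.distFun_eq (hM : Model P X T f q) (i : ℕ) (v : ℝ) :
    distFun f v = (P.map (X i)).real (Set.Iic v) := by
  rw [distFun, hM.law_X i, Measure.real, withDensity_apply _ measurableSet_Iic,
    integral_eq_lintegral_of_nonneg_ae (ae_of_all _ hM.f_nonneg)
      hM.measurable_f.aestronglyMeasurable]

lemma Model.distFun_nonneg (hM : Model P X T f q) (v : ℝ) : 0 ≤ distFun f v :=
  setIntegral_nonneg measurableSet_Iic fun u _ => hM.f_nonneg u

lemma Model.distFun_le_one [IsProbabilityMeasure P] (hM : Model P X T f q) (v : ℝ) :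
    distFun f v ≤ 1 := by
  have := Measure.isProbabilityMeasure_map (μ := P) (hM.measurable_X 0).aemeasurable
  rw [hM.distFun_eq 0]
  exact measureReal_le_one

lemma Model.measurable_distFun [IsProbabilityMeasure P] (hM : Model P X T f q) :
    Measurable (distFun f) := by
  have : Monotone (distFun f) := fun a b hab =>
    setIntegral_mono_set hM.integrable_f.integrableOn (ae_of_all _ hM.f_nonneg)
      (Set.Iic_subset_Iic.2 hab).eventuallyLE
  exact this.measurable

lemma Model.distFun_of_neg (hM : Model P X T f q) {v : ℝ} (hv : v < 0) : distFun f v = 0 :=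
  setIntegral_eq_zero_of_forall_eq_zero fun u hu =>
    hM.f_eq_zero u fun h => absurd (lt_of_le_of_lt hu hv) (not_lt.2 h.1)

lemma Model.distFun_of_one_le [IsProbabilityMeasure P] (hM : Model P X T f q) {v : ℝ} (hv : 1 ≤ v) :
    distFun f v = 1 := by
  have h1 : distFun f v = ∫ u, f u :=
    setIntegral_eq_integral_of_forall_compl_eq_zero fun u hu =>
      hM.f_eq_zero u fun h => hu (h.2.trans hv)
  rw [h1, integral_eq_lintegral_of_nonneg_ae (ae_of_all _ hM.f_nonneg)
      hM.measurable_f.aestronglyMeasurable, hM.lintegral_f, ENNReal.toReal_one]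

/-- Only the branch `Δ = 1` reaches below `1`. The point `1` itself is excluded because `q 0` is
positive. -/
lemma Model.densV_of_lt_one [IsProbabilityMeasure P] (hM : Model P X T f q) {v : ℝ} (hv : v < 1) :
    densV f q v = q v * distFun f v := by
  have h1 : v - 1 < 0 := by linarith
  rw [densV, hM.distFun_of_neg h1, hM.q_eq_zero (v - 1) fun h => absurd h.1 (not_le.2 h1)]
  ring

lemma Model.densV_of_one_lt [IsProbabilityMeasure P] (hM : Model P X T f q) {v : ℝ} (hv : 1 < v) :
    densV f q v = q (v - 1) * (1 - distFun f (v - 1)) := by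
  rw [densV, hM.distFun_of_one_le hv.le, hM.q_eq_zero v fun h => absurd h.2 (not_le.2 hv)]
  ring

/-- Given `T = t`, the status is Bernoulli with success probability `F t`. -/
lemma Model.integral_status [IsProbabilityMeasure P] (hM : Model P X T f q) (i : ℕ) (φ : ℝ → ℝ)
    (t : ℝ) :
    ∫ y, φ (transformed t (status y t)) ∂(P.map (X i))
      = φ t * distFun f t + φ (t + 1) * (1 - distFun f t) := by
  have := Measure.isProbabilityMeasure_map (μ := P) (hM.measurable_X i).aemeasurable
  have h (y : ℝ) : φ (transformed t (status y t))
      = φ (t + 1) + (Set.Iic t).indicator (fun _ => φ t - φ (t + 1)) y := by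
    rw [transformed_status]
    by_cases hy : y ≤ t <;> simp [hy]
  simp only [h]
  rw [integral_add (integrable_const _) ((integrable_const _).indicator measurableSet_Iic),
    integral_indicator measurableSet_Iic, setIntegral_const, ← hM.distFun_eq i]
  simp
  ring

/-- The transformed observations have density `densV f q`. -/
lemma Model.integral_obsV [IsProbabilityMeasure P] (hM : Model P X T f q) {φ : ℝ → ℝ}
    (hφ : Measurable φ) {C : ℝ} (hC : ∀ v, |φ v| ≤ C) :
    ∫ v, φ v ∂(P.map (obsV X T 0)) = ∫ v, φ v * densV f q v := by
  have hX := Measure.isProbabilityMeasure_map (μ := P) (hM.measurable_X 0).aemeasurable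
  have hT := Measure.isProbabilityMeasure_map (μ := P) (hM.measurable_T 0).aemeasurable
  have hpair := (hM.measurable_X 0).prodMk (hM.measurable_T 0)
  have hmeas : Measurable fun p : ℝ × ℝ => φ (transformed p.2 (status p.1 p.2)) :=
    hφ.comp measurable_transformed_status
  have step1 : ∫ v, φ v ∂(P.map (obsV X T 0))
      = ∫ p, φ (transformed p.2 (status p.1 p.2)) ∂((P.map (X 0)).prod (P.map (T 0))) := by
    rw [integral_map (hM.measurable_obsV 0).aemeasurable hφ.aestronglyMeasurable,
      ← hM.map_pair 0, integral_map hpair.aemeasurable hmeas.aestronglyMeasurable]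
    rfl
  have hF := hM.measurable_distFun
  have hqi := hM.integrable_q
  have hF1 (t : ℝ) : ‖distFun f t‖ ≤ 1 := by
    rw [Real.norm_of_nonneg (hM.distFun_nonneg t)]; exact hM.distFun_le_one t
  have hF2 (t : ℝ) : ‖1 - distFun f t‖ ≤ 1 := by
    rw [Real.norm_of_nonneg (by linarith [hM.distFun_le_one t])]; linarith [hM.distFun_nonneg t]
  have hC0 : 0 ≤ C := (abs_nonneg _).trans (hC 0)
  have i1 : Integrable fun t => q t * (φ t * distFun f t) := by
    refine hqi.mul_bdd (c := C) (hφ.mul hF).aestronglyMeasurable (ae_of_all _ fun t => ?_)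
    rw [norm_mul]
    exact (mul_le_mul (hC t) (hF1 t) (norm_nonneg _) hC0).trans (mul_one C).le
  have i2 : Integrable fun t => q t * (φ (t + 1) * (1 - distFun f t)) := by
    refine hqi.mul_bdd (c := C) ((hφ.comp (measurable_id.add_const 1)).mul
      (hF.const_sub 1)).aestronglyMeasurable (ae_of_all _ fun t => ?_)
    rw [norm_mul]
    exact (mul_le_mul (hC _) (hF2 t) (norm_nonneg _) hC0).trans (mul_one C).le
  have i3 : Integrable fun v => q (v - 1) * (φ v * (1 - distFun f (v - 1))) := by
    simpa using i2.comp_sub_right 1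
  have shift : ∫ t, q t * (φ (t + 1) * (1 - distFun f t))
      = ∫ v, q (v - 1) * (φ v * (1 - distFun f (v - 1))) := by
    -- The translation by one moves the branch `Δ = 0` to its place above `1`.
    rw [← integral_sub_right_eq_self (fun t => q t * (φ (t + 1) * (1 - distFun f t))) 1]
    simp
  rw [step1, integral_prod_symm _ (integrable_of_abs_le hmeas fun p => hC _)]
  simp only [hM.integral_status 0 φ]
  rw [hM.law_T 0, integral_withDensity_eq_integral_toReal_smul hM.measurable_q.ennreal_ofReal
    (ae_of_all _ fun _ => ENNReal.ofReal_lt_top)]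
  simp only [ENNReal.toReal_ofReal (hM.q_nonneg _), smul_eq_mul, mul_add]
  rw [integral_add i1 i2, shift, ← integral_add i1 i3]
  refine integral_congr_ae ?_
  -- At `v = 1` both branches overlap and the formulas can disagree, but a single point is Lebesgue
  -- null.
  filter_upwards [compl_mem_ae_iff.2 (measure_singleton (μ := volume) (1 : ℝ))] with v hv
  rcases lt_or_gt_of_ne (show v ≠ 1 from hv) with h | h
  · have h1 : v - 1 < 0 := by linarith
    rw [hM.densV_of_lt_one h, hM.q_eq_zero (v - 1) fun h => absurd h.1 (not_le.2 h1)]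
    ring
  · rw [hM.densV_of_one_lt h, hM.q_eq_zero v fun h' => absurd h'.2 (not_le.2 h)]
    ring

end Law

/-! ### Smoothness of the distribution function and of the density of `V`. -/

section Regularity

variable {Ω : Type*} [MeasurableSpace Ω] {P : Measure Ω} [IsProbabilityMeasure P]
  {X T : ℕ → Ω → ℝ} {f q : ℝ → ℝ} {x : ℝ}

/-- The fundamental theorem of calculus, after moving the base point from `-∞` to `0`. -/
lemma Model.hasDerivAt_distFun (hM : Model P X T f q) {s : ℝ} (hs : ContinuousAt f s) :
    HasDerivAt (distFun f) (f s) s := by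
  have hi := hM.integrable_f
  have h1 : HasDerivAt (fun v => ∫ u in (0 : ℝ)..v, f u) (f s) s :=
    intervalIntegral.integral_hasDerivAt_right hi.intervalIntegrable
      hM.measurable_f.stronglyMeasurable.stronglyMeasurableAtFilter hs
  have h2 : distFun f = fun v => distFun f 0 + ∫ u in (0 : ℝ)..v, f u := by
    ext v
    rw [← intervalIntegral.integral_Iic_sub_Iic hi.integrableOn hi.integrableOn]
    simp [distFun]
  rw [h2]
  exact h1.const_add _

/-- Integration gains one derivative. The regularity of `f` is first spread to a ball, since the
derivative of `F` must be identified with `f` around `x` and not just at `x`. -/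
lemma Model.contDiffAt_distFun (hM : Model P X T f q) (hf : ContDiffAt ℝ 2 f x) :
    ContDiffAt ℝ 3 (distFun f) x := by
  obtain ⟨δ, hδ, hball⟩ := Metric.eventually_nhds_iff_ball.1 (hf.eventually (by simp))
  have hd : ∀ s ∈ Metric.ball x δ, HasDerivAt (distFun f) (f s) s := fun s hs =>
    hM.hasDerivAt_distFun (hball s hs).continuousAt
  have h : ContDiffOn ℝ (2 + 1) (distFun f) (Metric.ball x δ) := by
    refine (contDiffOn_succ_iff_deriv_of_isOpen Metric.isOpen_ball).2
      ⟨fun s hs => (hd s hs).differentiableAt.differentiableWithinAt, by simp, ?_⟩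
    exact ContDiffOn.congr (fun s hs => (hball s hs).contDiffWithinAt) fun s hs => (hd s hs).deriv
  have h3 : (2 + 1 : WithTop ℕ∞) = 3 := by norm_num
  rw [h3] at h
  exact h.contDiffAt (Metric.ball_mem_nhds x hδ)

lemma Model.densV_eventuallyEq_left (hM : Model P X T f q) (hx : x ∈ Set.Ioo (0 : ℝ) 1) :
    densV f q =ᶠ[𝓝 x] fun v => q v * distFun f v := by
  filter_upwards [Iio_mem_nhds hx.2] with v hv using hM.densV_of_lt_one hv

lemma Model.densV_eventuallyEq_right (hM : Model P X T f q) (hx : x ∈ Set.Ioo (0 : ℝ) 1) :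
    densV f q =ᶠ[𝓝 (x + 1)] fun v => q (v - 1) * (1 - distFun f (v - 1)) := by
  filter_upwards [Ioi_mem_nhds (show (1 : ℝ) < x + 1 by linarith [hx.1])] with v hv
    using hM.densV_of_one_lt hv

lemma Model.contDiffAt_densV_left (hM : Model P X T f q) (hx : x ∈ Set.Ioo (0 : ℝ) 1)
    (hf : ContDiffAt ℝ 2 f x) (hq : ContDiffAt ℝ 3 q x) : ContDiffAt ℝ 3 (densV f q) x :=
  (hq.mul (hM.contDiffAt_distFun hf)).congr_of_eventuallyEq (hM.densV_eventuallyEq_left hx)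

lemma Model.contDiffAt_densV_right (hM : Model P X T f q) (hx : x ∈ Set.Ioo (0 : ℝ) 1)
    (hf : ContDiffAt ℝ 2 f x) (hq : ContDiffAt ℝ 3 q x) : ContDiffAt ℝ 3 (densV f q) (x + 1) := by
  refine ContDiffAt.congr_of_eventuallyEq ?_ (hM.densV_eventuallyEq_right hx)
  have hsub : ContDiffAt ℝ 3 (fun v : ℝ => v - 1) (x + 1) := by fun_prop
  have h : ContDiffAt ℝ 3 (fun v => q v * (1 - distFun f v)) ((fun v : ℝ => v - 1) (x + 1)) := by
    simpa using hq.mul (contDiffAt_const.sub (hM.contDiffAt_distFun hf))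
  exact h.comp (x + 1) hsub

/-- The product rule for `q F`. Dividing by `q` and subtracting `q' / q²` times the density leaves
`f x`, which is the identity behind `fLeft`. -/
lemma Model.deriv_densV_left (hM : Model P X T f q) (hx : x ∈ Set.Ioo (0 : ℝ) 1)
    (hf : ContDiffAt ℝ 2 f x) (hq : ContDiffAt ℝ 3 q x) :
    deriv (densV f q) x = deriv q x * distFun f x + q x * f x := by
  rw [(hM.densV_eventuallyEq_left hx).deriv_eq]
  exact ((hq.differentiableAt (by simp)).hasDerivAt.mul
    (hM.hasDerivAt_distFun hf.continuousAt)).deriv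

/-- Here the factor is `1 - F`, so `f` appears with the opposite sign; hence the overall minus in
`fRight`. -/
lemma Model.deriv_densV_right (hM : Model P X T f q) (hx : x ∈ Set.Ioo (0 : ℝ) 1)
    (hf : ContDiffAt ℝ 2 f x) (hq : ContDiffAt ℝ 3 q x) :
    deriv (densV f q) (x + 1) = deriv q x * (1 - distFun f x) - q x * f x := by
  rw [(hM.densV_eventuallyEq_right hx).deriv_eq,
    deriv_comp_sub_const (f := fun v => q v * (1 - distFun f v)), add_sub_cancel_right]
  rw [((hq.differentiableAt (by simp)).hasDerivAt.fun_mul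
    ((hM.hasDerivAt_distFun hf.continuousAt).const_sub 1)).deriv]
  ring

end Regularity

/-! ### Mean and second moment of one kernel contribution. -/

section KernelStat

/-- The contribution of one observation `v` to `α g'_{nh}(y) + β g_{nh}(y)`. -/
noncomputable def kernelStat (w : ℝ → ℝ) (α β y h v : ℝ) : ℝ :=
  α * (1 / h ^ 2 * deriv w ((y - v) / h)) + β * (1 / h * w ((y - v) / h))

/-- `ν` has density `g`, tested against bounded measurable functions. -/
def HasTestDensity (ν : Measure ℝ) (g : ℝ → ℝ) : Prop :=
  ∀ (φ : ℝ → ℝ) (C : ℝ), Measurable φ → (∀ v, |φ v| ≤ C) → ∫ v, φ v ∂ν = ∫ v, φ v * g v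

variable {w g : ℝ → ℝ} {ν : Measure ℝ} {y : ℝ}

lemma exists_abs_le_of_support_subset {κ : ℝ → ℝ} (hκ : Continuous κ)
    (hs : Function.support κ ⊆ Set.Icc (-1) 1) : ∃ C, ∀ u, |κ u| ≤ C :=
  (hasCompactSupport_of_support_subset hs).exists_bound_of_continuous hκ

lemma measurable_scaled {κ : ℝ → ℝ} (hκ : Continuous κ) (y h : ℝ) :
    Measurable fun v => κ ((y - v) / h) :=
  hκ.measurable.comp ((measurable_id.const_sub y).div_const h)

lemma integrable_scaled [IsFiniteMeasure ν] {κ : ℝ → ℝ} (hκ : Continuous κ)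
    (hs : Function.support κ ⊆ Set.Icc (-1) 1) (y h : ℝ) :
    Integrable (fun v => κ ((y - v) / h)) ν := by
  obtain ⟨C, hC⟩ := exists_abs_le_of_support_subset hκ hs
  exact integrable_of_abs_le (measurable_scaled hκ y h) fun v => hC _

/-- The substitution `v = y - h u`. -/
lemma integral_scaled (hν : HasTestDensity ν g) {κ : ℝ → ℝ} (hκ : Continuous κ)
    (hs : Function.support κ ⊆ Set.Icc (-1) 1) (y : ℝ) {h : ℝ} (hh : 0 < h) :
    ∫ v, κ ((y - v) / h) ∂ν = h * ∫ u, κ u * g (y - h * u) := by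
  obtain ⟨C, hC⟩ := exists_abs_le_of_support_subset hκ hs
  rw [hν _ C (measurable_scaled hκ y h) fun v => hC _,
    ← integral_sub_left_eq_self (fun v => κ ((y - v) / h) * g v) volume y]
  simp only [sub_sub_cancel]
  have h1 := Measure.integral_comp_mul_left (fun s => κ (s / h) * g (y - s)) h
  have h2 (u : ℝ) : h * u / h = u := by field_simp
  simp only [h2, smul_eq_mul] at h1
  rw [h1, abs_of_pos (inv_pos.2 hh), mul_inv_cancel_left₀ hh.ne']

lemma IsKernel.measurable_kernelStat (hw : IsKernel w) (α β y h : ℝ) :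
    Measurable (kernelStat w α β y h) :=
  (((measurable_scaled hw.continuous_deriv y h).const_mul _).const_mul _).add
    (((measurable_scaled hw.continuous y h).const_mul _).const_mul _)

/-- The derivative term is of order `h⁻²` and, for `h ≤ 1`, dominates the term of order `h⁻¹`. -/
lemma IsKernel.exists_kernelStat_bound (hw : IsKernel w) (α β : ℝ) :
    ∃ C, 0 ≤ C ∧ ∀ y h v, 0 < h → h ≤ 1 → |kernelStat w α β y h v| ≤ C / h ^ 2 := by
  obtain ⟨C1, h1⟩ := exists_abs_le_of_support_subset hw.continuous_deriv hw.support_deriv_subset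
  obtain ⟨C0, h0⟩ := exists_abs_le_of_support_subset hw.continuous hw.support_subset
  have hC1 : 0 ≤ C1 := (abs_nonneg _).trans (h1 0)
  have hC0 : 0 ≤ C0 := (abs_nonneg _).trans (h0 0)
  refine ⟨|α| * C1 + |β| * C0, by positivity, fun y h v hh hle => ?_⟩
  have e : kernelStat w α β y h v
      = (α * deriv w ((y - v) / h) + β * (h * w ((y - v) / h))) / h ^ 2 := by
    rw [kernelStat]; field_simp
  rw [e, abs_div, abs_of_pos (by positivity : 0 < h ^ 2)]
  gcongr
  refine (abs_add_le _ _).trans ?_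
  rw [abs_mul, abs_mul β, abs_mul h, abs_of_pos hh]
  have a1 := h1 ((y - v) / h)
  have a2 : h * |w ((y - v) / h)| ≤ C0 :=
    (mul_le_of_le_one_left (abs_nonneg _) hle).trans (h0 _)
  gcongr

lemma IsKernel.kernelStat_eq_zero (hw : IsKernel w) (α β : ℝ) {h v : ℝ} (hh : 0 < h)
    (hv : h < |y - v|) : kernelStat w α β y h v = 0 := by
  have hu : (y - v) / h ∉ Set.Icc (-1 : ℝ) 1 := fun hmem => by
    have := abs_le.2 hmem
    rw [abs_div, abs_of_pos hh, div_le_one hh] at this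
    linarith
  have h1 : w ((y - v) / h) = 0 := by_contra fun h => hu (hw.support_subset h)
  have h2 : deriv w ((y - v) / h) = 0 := by_contra fun h => hu (hw.support_deriv_subset h)
  simp [kernelStat, h1, h2]

lemma IsKernel.integral_kernelStat [IsFiniteMeasure ν] (hw : IsKernel w)
    (hν : HasTestDensity ν g) (α β y : ℝ) {h : ℝ} (hh : 0 < h) :
    ∫ v, kernelStat w α β y h v ∂ν
      = α * (1 / h * ∫ u, deriv w u * g (y - h * u)) + β * ∫ u, w u * g (y - h * u) := by
  simp only [kernelStat]
  rw [integral_add (((integrable_scaled hw.continuous_deriv hw.support_deriv_subset y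
      h).const_mul _).const_mul _)
    (((integrable_scaled hw.continuous hw.support_subset y h).const_mul _).const_mul _)]
  simp only [integral_const_mul]
  rw [integral_scaled hν hw.continuous_deriv hw.support_deriv_subset y hh,
    integral_scaled hν hw.continuous hw.support_subset y hh]
  field_simp

/-- Second order expansion of the mean of `kernelStat`. -/
lemma IsKernel.isLittleO_integral_kernelStat [IsFiniteMeasure ν] (hw : IsKernel w)
    (hν : HasTestDensity ν g) (α β : ℝ) (hg : ContDiffAt ℝ 3 g y) :
    (fun h => (∫ v, kernelStat w α β y h v ∂ν) - ((α * deriv g y + β * g y)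
      + 1 / 2 * h ^ 2 * (∫ v, v ^ 2 * w v) *
        (α * iteratedDeriv 3 g y + β * iteratedDeriv 2 g y))) =o[𝓝[>] 0] fun h => h ^ 2 := by
  -- Integration by parts turns the `deriv w` term into a smoother of `deriv g`, whose second-order
  -- expansion costs the third derivative of `g`.
  have hg' : ContDiffAt ℝ 2 (deriv g) y := hg.derivWithin (by norm_num)
  have h1 := hw.isLittleO_integral_mul hg'
  have h0 := hw.isLittleO_integral_mul (hg.of_le (by norm_num) : ContDiffAt ℝ 2 g y)
  refine ((h1.const_mul_left α).add (h0.const_mul_left β)).congr' ?_ EventuallyEq.rfl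
  filter_upwards [self_mem_nhdsWithin,
    hw.eventually_integral_deriv_mul (hg.of_le (by norm_num) : ContDiffAt ℝ 1 g y)] with h hh hparts
  have hh0 : (0 : ℝ) < h := hh
  rw [hw.integral_kernelStat hν α β y hh0, hparts, iteratedDeriv_succ' (n := 2) (f := g)]
  field_simp
  ring

/-- The second moment of `kernelStat` is of exact order `h⁻³`. -/
lemma IsKernel.tendsto_integral_kernelStat_sq [IsFiniteMeasure ν] (hw : IsKernel w)
    (hν : HasTestDensity ν g) (α β : ℝ) (hg : ContDiffAt ℝ 3 g y) :
    Tendsto (fun h => h ^ 3 * ∫ v, kernelStat w α β y h v ^ 2 ∂ν) (𝓝[>] 0)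
      (𝓝 (α ^ 2 * g y * ∫ u, deriv w u ^ 2)) := by
  have hc := eventually_continuousAt_of_contDiffAt (n := 3) hg
  have cw := hw.continuous
  have cd := hw.continuous_deriv
  have s1 : Function.support (fun u => deriv w u ^ 2) ⊆ Set.Icc (-1) 1 :=
    fun u hu => hw.support_deriv_subset fun h0 => hu (by simp [h0])
  have s2 : Function.support (fun u => deriv w u * w u) ⊆ Set.Icc (-1) 1 :=
    (Function.support_mul_subset_left _ _).trans hw.support_deriv_subset
  have s3 : Function.support (fun u => w u ^ 2) ⊆ Set.Icc (-1) 1 :=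
    fun u hu => hw.support_subset fun h0 => hu (by simp [h0])
  have c1 : Continuous fun u => deriv w u ^ 2 := cd.pow 2
  have c2 : Continuous fun u => deriv w u * w u := cd.mul cw
  have c3 : Continuous fun u => w u ^ 2 := cw.pow 2
  have t1 := tendsto_integral_kernel_mul c1 s1 hc
  have t2 := tendsto_integral_kernel_mul c2 s2 hc
  have t3 := tendsto_integral_kernel_mul c3 s3 hc
  have th : Tendsto (fun h : ℝ => h) (𝓝[>] 0) (𝓝 0) := nhdsWithin_le_nhds
  -- After multiplication by `h³` only the square of the derivative term survives; the mixed term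
  -- keeps a factor `h` and the last one a factor `h²`.
  have lim := ((t1.const_mul (α ^ 2)).add ((th.const_mul (2 * α * β)).mul t2)).add
    (((th.pow 2).const_mul (β ^ 2)).mul t3)
  have e : α ^ 2 * (g y * ∫ u, deriv w u ^ 2) + 2 * α * β * 0 * (g y * ∫ u, deriv w u * w u)
      + β ^ 2 * 0 ^ 2 * (g y * ∫ u, w u ^ 2) = α ^ 2 * g y * ∫ u, deriv w u ^ 2 := by ring
  rw [e] at lim
  refine lim.congr' ?_
  filter_upwards [self_mem_nhdsWithin] with h hh
  have hh0 : (0 : ℝ) < h := hh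
  have ex (v : ℝ) : kernelStat w α β y h v ^ 2
      = α ^ 2 / h ^ 4 * (deriv w ((y - v) / h) ^ 2)
        + 2 * α * β / h ^ 3 * (deriv w ((y - v) / h) * w ((y - v) / h))
        + β ^ 2 / h ^ 2 * (w ((y - v) / h) ^ 2) := by
    rw [kernelStat]; field_simp; ring
  simp only [ex]
  have i1 := integrable_scaled (ν := ν) c1 s1 y h
  have i2 := integrable_scaled (ν := ν) c2 s2 y h
  have i3 := integrable_scaled (ν := ν) c3 s3 y h
  rw [integral_add ((i1.const_mul _).fun_add (i2.const_mul _)) (i3.const_mul _),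
    integral_add (i1.const_mul _) (i2.const_mul _)]
  simp only [integral_const_mul]
  have j1 := integral_scaled hν c1 s1 y hh0
  have j2 := integral_scaled hν c2 s2 y hh0
  have j3 := integral_scaled hν c3 s3 y hh0
  rw [j1, j2, j3]
  field_simp

end KernelStat

/-! ### One observation's contribution to a combination of the left and right estimators. -/

section CombStat

variable {Ω : Type*} [MeasurableSpace Ω] {P : Measure Ω} {X T : ℕ → Ω → ℝ} {f q w : ℝ → ℝ} {x : ℝ}

/-- The contribution of one observation `v` to `a f⁻_{nh}(x) + b f⁺_{nh}(x)`. -/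
noncomputable def combStat (w q : ℝ → ℝ) (x a b h v : ℝ) : ℝ :=
  a * kernelStat w (1 / q x) (-(deriv q x / q x ^ 2)) x h v
    + b * kernelStat w (-(1 / q x)) (deriv q x / q x ^ 2) (x + 1) h v

lemma sum_combStat (w q : ℝ → ℝ) (x a b : ℝ) (n : ℕ) (h : ℝ) (V : ℕ → ℝ) :
    a * fLeft w q n h V x + b * fRight w q n h V x
      = 1 / n * ∑ i ∈ Finset.range n, combStat w q x a b h (V i) := by
  simp only [fLeft, fRight, kde, kdeDeriv, combStat, kernelStat, Finset.sum_add_distrib,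
    ← Finset.mul_sum]
  ring

lemma IsKernel.measurable_combStat (hw : IsKernel w) (q : ℝ → ℝ) (x a b h : ℝ) :
    Measurable (combStat w q x a b h) :=
  ((hw.measurable_kernelStat _ _ _ _).const_mul _).add
    ((hw.measurable_kernelStat _ _ _ _).const_mul _)

lemma IsKernel.exists_combStat_bound (hw : IsKernel w) (q : ℝ → ℝ) (x a b : ℝ) :
    ∃ C, 0 ≤ C ∧ ∀ h v, 0 < h → h ≤ 1 → |combStat w q x a b h v| ≤ C / h ^ 2 := by
  obtain ⟨C1, p1, h1⟩ := hw.exists_kernelStat_bound (1 / q x) (-(deriv q x / q x ^ 2))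
  obtain ⟨C2, p2, h2⟩ := hw.exists_kernelStat_bound (-(1 / q x)) (deriv q x / q x ^ 2)
  refine ⟨|a| * C1 + |b| * C2, by positivity, fun h v hh hle => ?_⟩
  refine (abs_add_le _ _).trans ?_
  rw [abs_mul, abs_mul, add_div, mul_div_assoc, mul_div_assoc]
  have a1 := h1 x h v hh hle
  have a2 := h2 (x + 1) h v hh hle
  gcongr

lemma Model.hasTestDensity [IsProbabilityMeasure P] (hM : Model P X T f q) :
    HasTestDensity (P.map (obsV X T 0)) (densV f q) :=
  fun _ _ hφ hC => hM.integral_obsV hφ hC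

lemma integrable_kernelStat {ν : Measure ℝ} [IsFiniteMeasure ν] (hw : IsKernel w)
    (α β y h : ℝ) : Integrable (kernelStat w α β y h) ν :=
  (((integrable_scaled hw.continuous_deriv hw.support_deriv_subset y h).const_mul _).const_mul
    _).add (((integrable_scaled hw.continuous hw.support_subset y h).const_mul _).const_mul _)

/-- Bias expansion of the combined estimator. -/
lemma Model.isLittleO_integral_combStat [IsProbabilityMeasure P] (hM : Model P X T f q)
    (hw : IsKernel w) (hx : x ∈ Set.Ioo (0 : ℝ) 1) (hf : ContDiffAt ℝ 2 f x)
    (hq : ContDiffAt ℝ 3 q x) (a b : ℝ) :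
    (fun h => (∫ v, combStat w q x a b h v ∂(P.map (obsV X T 0)))
      - ((a + b) * f x + 1 / 2 * h ^ 2 * (∫ v, v ^ 2 * w v) *
        (a * bLeft f q x + b * bRight f q x))) =o[𝓝[>] 0] fun h => h ^ 2 := by
  have := Measure.isProbabilityMeasure_map (μ := P) (hM.measurable_obsV 0).aemeasurable
  have h1 := hw.isLittleO_integral_kernelStat hM.hasTestDensity (1 / q x)
    (-(deriv q x / q x ^ 2)) (hM.contDiffAt_densV_left hx hf hq)
  have h2 := hw.isLittleO_integral_kernelStat hM.hasTestDensity (-(1 / q x))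
    (deriv q x / q x ^ 2) (hM.contDiffAt_densV_right hx hf hq)
  refine ((h1.const_mul_left a).add (h2.const_mul_left b)).congr_left fun h => ?_
  simp only [combStat]
  rw [integral_add ((integrable_kernelStat hw _ _ _ _).const_mul _)
    ((integrable_kernelStat hw _ _ _ _).const_mul _), integral_const_mul, integral_const_mul,
    hM.deriv_densV_left hx hf hq, hM.deriv_densV_right hx hf hq, hM.densV_of_lt_one hx.2,
    hM.densV_of_one_lt (show (1 : ℝ) < x + 1 by linarith [hx.1]), add_sub_cancel_right,
    bLeft, bRight]
  have hq0 : q x ≠ 0 := (hM.q_pos x ⟨hx.1.le, hx.2.le⟩).ne'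
  field_simp
  ring

/-- The limit variance of `a f⁻_{nh}(x) + b f⁺_{nh}(x)` at rate `√(n h³)`. -/
noncomputable def combVar (w f q : ℝ → ℝ) (x a b : ℝ) : ℝ :=
  (a ^ 2 * distFun f x + b ^ 2 * (1 - distFun f x)) * (1 / q x) * ∫ u, deriv w u ^ 2

lemma Model.tendsto_integral_combStat_sq [IsProbabilityMeasure P] (hM : Model P X T f q)
    (hw : IsKernel w) (hx : x ∈ Set.Ioo (0 : ℝ) 1) (hf : ContDiffAt ℝ 2 f x)
    (hq : ContDiffAt ℝ 3 q x) (a b : ℝ) :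
    Tendsto (fun h => h ^ 3 * ∫ v, combStat w q x a b h v ^ 2 ∂(P.map (obsV X T 0))) (𝓝[>] 0)
      (𝓝 (combVar w f q x a b)) := by
  have := Measure.isProbabilityMeasure_map (μ := P) (hM.measurable_obsV 0).aemeasurable
  have h1 := hw.tendsto_integral_kernelStat_sq hM.hasTestDensity (1 / q x)
    (-(deriv q x / q x ^ 2)) (hM.contDiffAt_densV_left hx hf hq)
  have h2 := hw.tendsto_integral_kernelStat_sq hM.hasTestDensity (-(1 / q x))
    (deriv q x / q x ^ 2) (hM.contDiffAt_densV_right hx hf hq)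
  have lim := (h1.const_mul (a ^ 2)).add (h2.const_mul (b ^ 2))
  have hq0 : q x ≠ 0 := (hM.q_pos x ⟨hx.1.le, hx.2.le⟩).ne'
  have e : a ^ 2 * ((1 / q x) ^ 2 * densV f q x * ∫ u, deriv w u ^ 2)
      + b ^ 2 * ((-(1 / q x)) ^ 2 * densV f q (x + 1) * ∫ u, deriv w u ^ 2)
      = combVar w f q x a b := by
    rw [combVar, hM.densV_of_lt_one hx.2,
      hM.densV_of_one_lt (show (1 : ℝ) < x + 1 by linarith [hx.1]), add_sub_cancel_right]
    field_simp
  rw [e] at lim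
  refine lim.congr' ?_
  filter_upwards [Ioo_mem_nhdsGT (show (0 : ℝ) < 1 / 2 by norm_num)] with h hh
  -- For `h < 1/2` no `v` lies within `h` of both `x` and `x + 1`, so one of the two factors of the
  -- mixed term always vanishes.
  have hcross (v : ℝ) : combStat w q x a b h v ^ 2
      = a ^ 2 * kernelStat w (1 / q x) (-(deriv q x / q x ^ 2)) x h v ^ 2
        + b ^ 2 * kernelStat w (-(1 / q x)) (deriv q x / q x ^ 2) (x + 1) h v ^ 2 := by
    rw [combStat]
    rcases lt_or_ge h |x - v| with h3 | h3
    · rw [hw.kernelStat_eq_zero _ _ hh.1 h3]; ring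
    · have h4 : h < |x + 1 - v| := by
        have := (abs_le.1 h3).1
        rw [lt_abs]; left; linarith [hh.2]
      rw [hw.kernelStat_eq_zero _ _ hh.1 h4]; ring
  have hi (α β y : ℝ) : Integrable (fun v => kernelStat w α β y h v ^ 2) (P.map (obsV X T 0)) := by
    obtain ⟨C, _, hC⟩ := hw.exists_kernelStat_bound α β
    refine integrable_of_abs_le ((hw.measurable_kernelStat α β y h).pow_const 2)
      (C := (C / h ^ 2) ^ 2) fun v => ?_
    rw [abs_pow]
    have := hC y h v hh.1 (by linarith [hh.2])
    gcongr
  simp only [hcross]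
  rw [integral_add ((hi _ _ _).const_mul _) ((hi _ _ _).const_mul _), integral_const_mul,
    integral_const_mul]
  ring

end CombStat

/-! ### Asymptotics of combinations with fixed weights. -/

section LinEst

variable {Ω : Type*} {X T : ℕ → Ω → ℝ} {f q w : ℝ → ℝ} {x : ℝ} {h : ℕ → ℝ}

/-- The linear combination `a f⁻_{nh}(x) + b f⁺_{nh}(x)`, as a sequence of random variables. -/
noncomputable def linEst (w q : ℝ → ℝ) (X T : ℕ → Ω → ℝ) (h : ℕ → ℝ) (x a b : ℝ) (n : ℕ) (ω : Ω) :
    ℝ :=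
  a * fLeft w q n (h n) (fun i => obsV X T i ω) x + b * fRight w q n (h n) (fun i => obsV X T i ω) x

lemma linEst_eq_sum (w q : ℝ → ℝ) (X T : ℕ → Ω → ℝ) (h : ℕ → ℝ) (x a b : ℝ) (n : ℕ) (ω : Ω) :
    linEst w q X T h x a b n ω
      = 1 / n * ∑ i ∈ Finset.range n, combStat w q x a b (h n) (obsV X T i ω) :=
  sum_combStat w q x a b n (h n) _

lemma IsKernel.eventually_linEst_bounded (hw : IsKernel w) (hpos : ∀ n, 0 < h n)
    (h0 : Tendsto h atTop (𝓝 0)) (a b : ℝ) :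
    ∀ᶠ n in atTop, ∃ C, ∀ ω, |linEst w q X T h x a b n ω| ≤ C := by
  obtain ⟨C, -, hC⟩ := hw.exists_combStat_bound q x a b
  filter_upwards [h0.eventually_le_const one_pos] with n hn
  refine ⟨|1 / (n : ℝ)| * (n * (C / h n ^ 2)), fun ω => ?_⟩
  rw [linEst_eq_sum, abs_mul]
  exact mul_le_mul_of_nonneg_left
    (abs_rowSum_le (V := obsV X T) (fun v => hC (h n) v (hpos n) hn) n ω) (abs_nonneg _)

lemma rate_sq (hpos : ∀ n, 0 < h n) (n : ℕ) : rate h n ^ 2 = n * h n ^ 3 :=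
  Real.sq_sqrt (mul_nonneg n.cast_nonneg (pow_nonneg (hpos n).le 3))

lemma tendsto_rate (hn : Tendsto (fun n : ℕ => (n : ℝ) * h n ^ 3) atTop atTop) :
    Tendsto (rate h) atTop atTop :=
  Real.tendsto_sqrt_atTop.comp hn

variable [MeasurableSpace Ω] {P : Measure Ω}

/-- The mean of a single contribution to `linEst`. -/
noncomputable def linMean (P : Measure Ω) (w q : ℝ → ℝ) (X T : ℕ → Ω → ℝ) (h : ℕ → ℝ) (x a b : ℝ)
    (n : ℕ) : ℝ :=
  ∫ v, combStat w q x a b (h n) v ∂(P.map (obsV X T 0))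

/-- The centred and scaled contribution of one observation to `linEst`. -/
noncomputable def linTerm (P : Measure Ω) (w q : ℝ → ℝ) (X T : ℕ → Ω → ℝ) (h : ℕ → ℝ) (x a b : ℝ)
    (n : ℕ) (v : ℝ) : ℝ :=
  rate h n / n * (combStat w q x a b (h n) v - linMean P w q X T h x a b n)

lemma rate_mul_linEst_sub (P : Measure Ω) (w q : ℝ → ℝ) (X T : ℕ → Ω → ℝ) (h : ℕ → ℝ) (x a b : ℝ)
    (n : ℕ) (ω : Ω) :
    rate h n * (linEst w q X T h x a b n ω - linMean P w q X T h x a b n)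
      = ∑ i ∈ Finset.range n, linTerm P w q X T h x a b n (obsV X T i ω) := by
  simp only [linTerm, ← Finset.mul_sum, Finset.sum_sub_distrib, linEst_eq_sum]
  -- For `n = 0` both sides vanish, because `rate h 0 = 0`.
  rcases Nat.eq_zero_or_pos n with rfl | hn
  · simp [rate]
  · have : (n : ℝ) ≠ 0 := by positivity
    simp
    field_simp

lemma IsKernel.measurable_linTerm (hw : IsKernel w) (a b : ℝ) (n : ℕ) :
    Measurable (linTerm P w q X T h x a b n) :=
  ((hw.measurable_combStat _ _ _ _ _).sub_const _).const_mul _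

lemma Model.measurable_linEst (hM : Model P X T f q) (hw : IsKernel w) (a b : ℝ) (n : ℕ) :
    Measurable (linEst w q X T h x a b n) := by
  have : linEst w q X T h x a b n = fun ω => _ := funext (linEst_eq_sum w q X T h x a b n)
  rw [this]
  exact (measurable_rowSum hM.measurable_obsV (hw.measurable_combStat _ _ _ _ _) n).const_mul _

variable [IsProbabilityMeasure P]

lemma integrable_combStat {ν : Measure ℝ} [IsFiniteMeasure ν] (hw : IsKernel w)
    (q : ℝ → ℝ) (x a b h : ℝ) : Integrable (combStat w q x a b h) ν :=
  ((integrable_kernelStat hw _ _ _ _).const_mul _).add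
    ((integrable_kernelStat hw _ _ _ _).const_mul _)

lemma integrable_combStat_sq {ν : Measure ℝ} [IsFiniteMeasure ν] (hw : IsKernel w)
    (q : ℝ → ℝ) (x a b : ℝ) {h : ℝ} (hh : 0 < h) (hle : h ≤ 1) :
    Integrable (fun v => combStat w q x a b h v ^ 2) ν := by
  obtain ⟨C, _, hC⟩ := hw.exists_combStat_bound q x a b
  refine integrable_of_abs_le ((hw.measurable_combStat q x a b h).pow_const 2)
    (C := (C / h ^ 2) ^ 2) fun v => ?_
  rw [abs_pow]
  have := hC h v hh hle
  gcongr

lemma Model.integral_linEst (hM : Model P X T f q) (hw : IsKernel w) (a b : ℝ)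
    (hpos : ∀ n, 0 < h n) (h0 : Tendsto h atTop (𝓝 0)) :
    ∀ᶠ n in atTop, ∫ ω, linEst w q X T h x a b n ω ∂P = linMean P w q X T h x a b n := by
  obtain ⟨C, -, hC⟩ := hw.exists_combStat_bound q x a b
  filter_upwards [h0.eventually_le_const one_pos, eventually_gt_atTop 0] with n hn hn0
  simp only [linEst_eq_sum]
  rw [integral_const_mul, integral_rowSum hM.measurable_obsV hM.map_obsV
    (hw.measurable_combStat _ _ _ _ _) (fun v => hC (h n) v (hpos n) hn), linMean]
  have : (n : ℝ) ≠ 0 := by positivity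
  field_simp

/-- Bias expansion along the bandwidth sequence. -/
lemma Model.isLittleO_linMean (hM : Model P X T f q)
    (hw : IsKernel w) (hx : x ∈ Set.Ioo (0 : ℝ) 1) (hf : ContDiffAt ℝ 2 f x)
    (hq : ContDiffAt ℝ 3 q x) (hpos : ∀ n, 0 < h n) (h0 : Tendsto h atTop (𝓝 0)) (a b : ℝ) :
    (fun n => linMean P w q X T h x a b n
      - ((a + b) * f x + 1 / 2 * h n ^ 2 * (∫ v, v ^ 2 * w v) *
        (a * bLeft f q x + b * bRight f q x))) =o[atTop] fun n => h n ^ 2 :=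
  (hM.isLittleO_integral_combStat hw hx hf hq a b).comp_tendsto
    (tendsto_nhdsWithin_iff.2 ⟨h0, Eventually.of_forall hpos⟩)

/-- The form needed when only the order of the bias matters. With `a + b = 0` it says that the mean
of the contrast is `O(h²)`. -/
lemma Model.linMean_sub_isBigO (hM : Model P X T f q)
    (hw : IsKernel w) (hx : x ∈ Set.Ioo (0 : ℝ) 1) (hf : ContDiffAt ℝ 2 f x)
    (hq : ContDiffAt ℝ 3 q x) (hpos : ∀ n, 0 < h n) (h0 : Tendsto h atTop (𝓝 0)) (a b : ℝ) :
    (fun n => linMean P w q X T h x a b n - (a + b) * f x) =O[atTop] fun n => h n ^ 2 := by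
  have h1 := (hM.isLittleO_linMean hw hx hf hq hpos h0 a b).isBigO
  have h2 : (fun n => (1 / 2 * (∫ v, v ^ 2 * w v) * (a * bLeft f q x + b * bRight f q x))
      * h n ^ 2) =O[atTop] fun n => h n ^ 2 :=
    (isBigO_refl _ _).const_mul_left _
  exact (h1.add h2).congr_left fun n => by ring

lemma Model.integral_linTerm (hM : Model P X T f q) (hw : IsKernel w) (a b : ℝ) (n : ℕ) :
    ∫ v, linTerm P w q X T h x a b n v ∂(P.map (obsV X T 0)) = 0 := by
  have := Measure.isProbabilityMeasure_map (μ := P) (hM.measurable_obsV 0).aemeasurable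
  simp only [linTerm]
  rw [integral_const_mul, integral_sub (integrable_combStat hw _ _ _ _ _) (integrable_const _)]
  simp [linMean]

/-- A uniform bound on the scaled contributions, tending to zero. -/
lemma Model.exists_linTerm_bound (hM : Model P X T f q) (hw : IsKernel w)
    (hpos : ∀ n, 0 < h n) (h0 : Tendsto h atTop (𝓝 0))
    (hn : Tendsto (fun n : ℕ => (n : ℝ) * h n ^ 3) atTop atTop) (a b : ℝ) :
    ∃ B : ℕ → ℝ, (∀ᶠ n in atTop, ∀ v, |linTerm P w q X T h x a b n v| ≤ B n) ∧
      Tendsto B atTop (𝓝 0) := by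
  have := Measure.isProbabilityMeasure_map (μ := P) (hM.measurable_obsV 0).aemeasurable
  obtain ⟨C, hC0, hC⟩ := hw.exists_combStat_bound q x a b
  -- A centred term is at most `2 C / h²`, and `rate / (n h²) = h / rate` since `rate² = n h³`.
  refine ⟨fun n => 2 * C * (h n / rate h n), ?_, ?_⟩
  · filter_upwards [h0.eventually_le_const one_pos, eventually_gt_atTop 0] with n hle hn0 v
    have hc (v : ℝ) := hC (h n) v (hpos n) hle
    have hm : |linMean P w q X T h x a b n| ≤ C / h n ^ 2 := by
      have := norm_integral_le_of_norm_le_const (μ := P.map (obsV X T 0))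
        (f := combStat w q x a b (h n)) (ae_of_all _ hc)
      simpa [linMean] using this
    have hrate : 0 < rate h n :=
      Real.sqrt_pos.2 (mul_pos (by positivity) (pow_pos (hpos n) 3))
    rw [linTerm, abs_mul, abs_of_nonneg (by positivity : 0 ≤ rate h n / n)]
    calc _ ≤ rate h n / n * (C / h n ^ 2 + C / h n ^ 2) := by
          gcongr
          exact (abs_sub _ _).trans (add_le_add (hc v) hm)
      _ = 2 * C * (rate h n / (n * h n ^ 2)) := by ring
      _ = 2 * C * (h n / rate h n) := by
          congr 1
          have hp := hpos n
          have hnp : (0 : ℝ) < n := by positivity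
          rw [div_eq_div_iff (by positivity) (by positivity), ← sq, rate_sq hpos]
          ring
  · simpa using (h0.div_atTop (tendsto_rate hn)).const_mul (2 * C)

/-- The left side is `h³` times the second moment minus the squared mean. The means converge, so
`h³` times their square disappears. -/
lemma Model.tendsto_integral_linTerm_sq (hM : Model P X T f q)
    (hw : IsKernel w) (hx : x ∈ Set.Ioo (0 : ℝ) 1) (hf : ContDiffAt ℝ 2 f x)
    (hq : ContDiffAt ℝ 3 q x) (hpos : ∀ n, 0 < h n) (h0 : Tendsto h atTop (𝓝 0)) (a b : ℝ) :
    Tendsto (fun n : ℕ => n * ∫ v, linTerm P w q X T h x a b n v ^ 2 ∂(P.map (obsV X T 0))) atTop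
      (𝓝 (combVar w f q x a b)) := by
  have := Measure.isProbabilityMeasure_map (μ := P) (hM.measurable_obsV 0).aemeasurable
  have hpos' : Tendsto h atTop (𝓝[>] 0) :=
    tendsto_nhdsWithin_iff.2 ⟨h0, Eventually.of_forall hpos⟩
  have l1 := (hM.tendsto_integral_combStat_sq hw hx hf hq a b).comp hpos'
  have lm : Tendsto (linMean P w q X T h x a b) atTop (𝓝 ((a + b) * f x)) := by
    have := (hM.linMean_sub_isBigO hw hx hf hq hpos h0 a b).trans_tendsto
      (by simpa using h0.pow 2)
    simpa using this.add_const ((a + b) * f x)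
  have l2 : Tendsto (fun n => h n ^ 3 * linMean P w q X T h x a b n ^ 2) atTop (𝓝 0) := by
    simpa using (h0.pow 3).mul (lm.pow 2)
  have lim := l1.sub l2
  rw [sub_zero] at lim
  refine lim.congr' ?_
  filter_upwards [h0.eventually_le_const one_pos, eventually_gt_atTop 0] with n hle hn0
  have e (v : ℝ) : linTerm P w q X T h x a b n v ^ 2 = h n ^ 3 / n *
      (combStat w q x a b (h n) v ^ 2 - 2 * linMean P w q X T h x a b n *
        combStat w q x a b (h n) v + linMean P w q X T h x a b n ^ 2) := by
    rw [linTerm, mul_pow, div_pow, rate_sq hpos]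
    have : (n : ℝ) ≠ 0 := by positivity
    field_simp
    ring
  have i2 := integrable_combStat_sq (ν := P.map (obsV X T 0)) hw q x a b (hpos n) hle
  have i1 := integrable_combStat (ν := P.map (obsV X T 0)) hw q x a b (h n)
  simp only [e]
  rw [integral_const_mul, integral_add (i2.sub' (i1.const_mul _)) (integrable_const _),
    integral_sub i2 (i1.const_mul _), integral_const_mul,
    show ∫ v, combStat w q x a b (h n) v ∂(P.map (obsV X T 0))
      = linMean P w q X T h x a b n from rfl]
  have : (n : ℝ) ≠ 0 := by positivity
  simp
  field_simp
  ring

/-- Asymptotic normality of `a f⁻_{nh}(x) + b f⁺_{nh}(x)`. -/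
lemma Model.tendstoNormal_linEst (hM : Model P X T f q)
    (hw : IsKernel w) (hx : x ∈ Set.Ioo (0 : ℝ) 1) (hf : ContDiffAt ℝ 2 f x)
    (hq : ContDiffAt ℝ 3 q x) (hpos : ∀ n, 0 < h n) (h0 : Tendsto h atTop (𝓝 0))
    (hn : Tendsto (fun n : ℕ => (n : ℝ) * h n ^ 3) atTop atTop) (a b : ℝ) :
    TendstoNormal P (fun n ω => rate h n *
      (linEst w q X T h x a b n ω - linMean P w q X T h x a b n)) (combVar w f q x a b) := by
  have := Measure.isProbabilityMeasure_map (μ := P) (hM.measurable_obsV 0).aemeasurable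
  obtain ⟨B, hB, hB0⟩ := hM.exists_linTerm_bound (x := x) hw hpos h0 hn a b
  simp only [rate_mul_linEst_sub]
  exact tendstoNormal_rowSum hM.measurable_obsV hM.iIndepFun_obsV hM.map_obsV
    (fun n => hw.measurable_linTerm a b n) hB hB0
    (Eventually.of_forall fun n => hM.integral_linTerm hw a b n)
    (hM.tendsto_integral_linTerm_sq hw hx hf hq hpos h0 a b)

/-- Convergence in law does not give convergence of second moments; the exact variance formula for
row sums does. -/
lemma Model.tendsto_integral_linEst_sq (hM : Model P X T f q)
    (hw : IsKernel w) (hx : x ∈ Set.Ioo (0 : ℝ) 1) (hf : ContDiffAt ℝ 2 f x)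
    (hq : ContDiffAt ℝ 3 q x) (hpos : ∀ n, 0 < h n) (h0 : Tendsto h atTop (𝓝 0))
    (hn : Tendsto (fun n : ℕ => (n : ℝ) * h n ^ 3) atTop atTop) (a b : ℝ) :
    Tendsto (fun n => ∫ ω, (rate h n *
      (linEst w q X T h x a b n ω - linMean P w q X T h x a b n)) ^ 2 ∂P) atTop
      (𝓝 (combVar w f q x a b)) := by
  obtain ⟨B, hB, -⟩ := hM.exists_linTerm_bound (x := x) hw hpos h0 hn a b
  refine (hM.tendsto_integral_linTerm_sq hw hx hf hq hpos h0 a b).congr' ?_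
  filter_upwards [hB] with n hBn
  simp only [rate_mul_linEst_sub]
  exact (integral_rowSum_pow hM.measurable_obsV hM.iIndepFun_obsV hM.map_obsV
    (hw.measurable_linTerm a b n) hBn (hM.integral_linTerm hw a b n) n).1.symm

/-- In the exact fourth moment, `n m₄ ≤ B² (n m₂) → 0`, where `mₖ` are the moments of one scaled
term, and the rest is at most `3 (n m₂)²`, which converges. -/
lemma Model.exists_integral_linEst_pow_four_le (hM : Model P X T f q)
    (hw : IsKernel w) (hx : x ∈ Set.Ioo (0 : ℝ) 1) (hf : ContDiffAt ℝ 2 f x)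
    (hq : ContDiffAt ℝ 3 q x) (hpos : ∀ n, 0 < h n) (h0 : Tendsto h atTop (𝓝 0))
    (hn : Tendsto (fun n : ℕ => (n : ℝ) * h n ^ 3) atTop atTop) (a b : ℝ) :
    ∃ C, ∀ᶠ n in atTop, ∫ ω, (rate h n *
      (linEst w q X T h x a b n ω - linMean P w q X T h x a b n)) ^ 4 ∂P ≤ C := by
  have := Measure.isProbabilityMeasure_map (μ := P) (hM.measurable_obsV 0).aemeasurable
  obtain ⟨B, hB, hB0⟩ := hM.exists_linTerm_bound (x := x) hw hpos h0 hn a b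
  have l2 := hM.tendsto_integral_linTerm_sq hw hx hf hq hpos h0 a b
  have lim := ((hB0.pow 2).mul l2).add ((l2.pow 2).const_mul 3)
  -- The limit of the upper bound, written as `lim` produces it, plus one.
  refine ⟨0 ^ 2 * combVar w f q x a b + 3 * combVar w f q x a b ^ 2 + 1, ?_⟩
  filter_upwards [hB, lim.eventually_le_const (lt_add_one _)] with n hBn hle
  refine le_trans ?_ hle
  simp only [rate_mul_linEst_sub]
  rw [(integral_rowSum_pow hM.measurable_obsV hM.iIndepFun_obsV hM.map_obsV
    (hw.measurable_linTerm a b n) hBn (hM.integral_linTerm hw a b n) n).2]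
  have hm := hw.measurable_linTerm (P := P) (q := q) (X := X) (T := T) (h := h) (x := x) a b n
  have hi (k : ℕ) : Integrable (fun v => linTerm P w q X T h x a b n v ^ k)
      (P.map (obsV X T 0)) := by
    refine integrable_of_abs_le (hm.pow_const k) (C := B n ^ k) fun v => ?_
    rw [abs_pow]
    have := hBn v
    gcongr
  have h4 : ∫ v, linTerm P w q X T h x a b n v ^ 4 ∂(P.map (obsV X T 0))
      ≤ B n ^ 2 * ∫ v, linTerm P w q X T h x a b n v ^ 2 ∂(P.map (obsV X T 0)) := by
    rw [← integral_const_mul]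
    refine integral_mono (hi 4) ((hi 2).const_mul _) fun v => ?_
    have : linTerm P w q X T h x a b n v ^ 2 ≤ B n ^ 2 := sq_le_sq' (abs_le.1 (hBn v)).1
      (abs_le.1 (hBn v)).2
    calc linTerm P w q X T h x a b n v ^ 4
        = linTerm P w q X T h x a b n v ^ 2 * linTerm P w q X T h x a b n v ^ 2 := by ring
      _ ≤ _ := by gcongr
  set m2 := ∫ v, linTerm P w q X T h x a b n v ^ 2 ∂(P.map (obsV X T 0))
  have hn0 : (0 : ℝ) ≤ n := n.cast_nonneg
  have h5 : (n : ℝ) * ∫ v, linTerm P w q X T h x a b n v ^ 4 ∂(P.map (obsV X T 0))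
      ≤ n * (B n ^ 2 * m2) := by gcongr
  nlinarith [mul_nonneg hn0 (sq_nonneg m2)]

end LinEst

/-! ### Negligible perturbations in law and in mean square. -/

section Perturbation

variable {Ω : Type*} [MeasurableSpace Ω] {P : Measure Ω}

lemma integral_abs_mul_le_sqrt {A B : Ω → ℝ} (hA : MemLp A 2 P) (hB : MemLp B 2 P) :
    ∫ ω, |A ω * B ω| ∂P ≤ √(∫ ω, A ω ^ 2 ∂P) * √(∫ ω, B ω ^ 2 ∂P) := by
  have h := integral_mul_norm_le_Lp_mul_Lq (μ := P) (f := A) (g := B) (p := 2) (q := 2)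
    Real.HolderConjugate.two_two (by simpa using hA) (by simpa using hB)
  simpa only [abs_mul, Real.sqrt_eq_rpow, Real.norm_eq_abs, Real.rpow_two, sq_abs] using h

lemma memLp_mul_of_abs_le {A B : Ω → ℝ} {p : ENNReal} (hA : MemLp A p P) (hB : Measurable B) {C : ℝ}
    (hC : ∀ ω, |B ω| ≤ C) : MemLp (fun ω => A ω * B ω) p P := by
  refine (hA.const_mul C).of_le (hA.aestronglyMeasurable.mul hB.aestronglyMeasurable)
    (ae_of_all _ fun ω => ?_)
  rw [norm_mul, norm_mul, mul_comm]
  exact mul_le_mul_of_nonneg_right ((hC ω).trans (le_abs_self C)) (norm_nonneg _)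

lemma tendstoInMeasure_of_integral_abs {R : ℕ → Ω → ℝ} (hm : ∀ n, Measurable (R n))
    (hi : ∀ᶠ n in atTop, Integrable (R n) P)
    (h0 : Tendsto (fun n => ∫ ω, |R n ω| ∂P) atTop (𝓝 0)) : TendstoInMeasure P R atTop 0 := by
  refine tendstoInMeasure_of_tendsto_eLpNorm (p := 1) one_ne_zero
    (fun n => (hm n).aestronglyMeasurable) aestronglyMeasurable_zero ?_
  have h1 : Tendsto (fun n => ENNReal.ofReal (∫ ω, |R n ω| ∂P)) atTop (𝓝 0) := by
    simpa using ENNReal.tendsto_ofReal h0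
  refine h1.congr' ?_
  filter_upwards [hi] with n hn
  rw [sub_zero, eLpNorm_one_eq_lintegral_enorm, ← ofReal_integral_norm_eq_lintegral_enorm hn]
  rfl

/-- A perturbation that vanishes in mean does not change the limit law. -/
lemma TendstoNormal.of_integral_abs_sub [IsProbabilityMeasure P] {Z Y : ℕ → Ω → ℝ} {s : ℝ}
    (hZ : TendstoNormal P Z s) (hZm : ∀ n, Measurable (Z n)) (hYm : ∀ n, Measurable (Y n))
    (hi : ∀ᶠ n in atTop, Integrable (fun ω => Y n ω - Z n ω) P)
    (h0 : Tendsto (fun n => ∫ ω, |Y n ω - Z n ω| ∂P) atTop (𝓝 0)) : TendstoNormal P Y s :=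
  tendstoInDistribution_of_tendstoInMeasure_sub Y id hZ
    (tendstoInMeasure_of_integral_abs (R := Y - Z) (fun n => (hYm n).sub (hZm n)) hi h0)
    fun n => (hYm n).aemeasurable

/-- A perturbation that vanishes in mean square does not change the limit of second moments. -/
lemma tendsto_integral_add_sq {A B : ℕ → Ω → ℝ} {s : ℝ}
    (hA : ∀ᶠ n in atTop, MemLp (A n) 2 P) (hB : ∀ᶠ n in atTop, MemLp (B n) 2 P)
    (hAs : Tendsto (fun n => ∫ ω, A n ω ^ 2 ∂P) atTop (𝓝 s))
    (hB0 : Tendsto (fun n => ∫ ω, B n ω ^ 2 ∂P) atTop (𝓝 0)) :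
    Tendsto (fun n => ∫ ω, (A n ω + B n ω) ^ 2 ∂P) atTop (𝓝 s) := by
  -- Cauchy–Schwarz: the second moments of `A n` stay bounded and those of `B n` vanish.
  have hcross : Tendsto (fun n => ∫ ω, A n ω * B n ω ∂P) atTop (𝓝 0) := by
    have hb : Tendsto (fun n => √(∫ ω, A n ω ^ 2 ∂P) * √(∫ ω, B n ω ^ 2 ∂P)) atTop (𝓝 0) := by
      simpa using hAs.sqrt.mul hB0.sqrt
    refine squeeze_zero_norm' ?_ hb
    filter_upwards [hA, hB] with n hAn hBn
    exact (norm_integral_le_integral_norm _).trans (integral_abs_mul_le_sqrt hAn hBn)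
  have lim := (hAs.add (hcross.const_mul 2)).add hB0
  rw [mul_zero, add_zero, add_zero] at lim
  refine lim.congr' ?_
  filter_upwards [hA, hB] with n hAn hBn
  have e (ω : Ω) : (A n ω + B n ω) ^ 2 = A n ω ^ 2 + 2 * (A n ω * B n ω) + B n ω ^ 2 := by ring
  have iAB : Integrable (fun ω => A n ω * B n ω) P := hAn.integrable_mul hBn
  simp only [e]
  rw [integral_add (hAn.integrable_sq.fun_add (iAB.const_mul 2)) hBn.integrable_sq,
    integral_add hAn.integrable_sq (iAB.const_mul 2), integral_const_mul]

lemma integral_sq_gaussianReal {s : ℝ} (hs : 0 ≤ s) :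
    ∫ y, y ^ 2 ∂(gaussianReal 0 s.toNNReal) = s := by
  have h := variance_id_gaussianReal (μ := 0) (v := s.toNNReal)
  rw [variance_of_integral_eq_zero aemeasurable_id (by simp), Real.coe_toNNReal s hs] at h
  exact h

lemma TendstoNormal.hasAsympMSE [IsProbabilityMeasure P] {r : ℕ → ℝ} {θ s : ℝ} {e : ℕ → Ω → ℝ}
    (hs : 0 ≤ s) (h : TendstoNormal P (fun n ω => r n * (e n ω - θ)) s) :
    HasAsympMSE P r θ e s := by
  refine ⟨gaussianReal 0 s.toNNReal, inferInstance, h, ?_, integral_sq_gaussianReal hs⟩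
  exact_mod_cast memLp_id_gaussianReal (μ := 0) (v := s.toNNReal) 2

end Perturbation

/-! ### Orders of the bandwidth. -/

section Bandwidth

variable {h : ℕ → ℝ}

lemma natCast_mul_rpow_pow {n : ℕ} (hn : 0 < n) : (n : ℝ) * ((n : ℝ) ^ (-(1 / 7) : ℝ)) ^ 7 = 1 := by
  have : (0 : ℝ) < n := by positivity
  rw [← Real.rpow_natCast, ← Real.rpow_mul this.le]
  norm_num
  rw [Real.rpow_neg_one]
  field_simp

/-- `rate * h²` is the order of the bias on the scale of the fluctuations; its square `n h⁷`
explains the exponent `1/7`. -/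
lemma rate_mul_sq_sq (hpos : ∀ n, 0 < h n) (n : ℕ) :
    (rate h n * h n ^ 2) ^ 2 = n * h n ^ 7 := by
  rw [mul_pow, rate_sq hpos]; ring

lemma tendsto_bandwidth_zero (hO : h =O[atTop] fun n : ℕ => (n : ℝ) ^ (-(1 / 7) : ℝ)) :
    Tendsto h atTop (𝓝 0) :=
  hO.trans_tendsto ((tendsto_rpow_neg_atTop (by norm_num)).comp tendsto_natCast_atTop_atTop)

lemma tendsto_mul_cube_atTop (hpos : ∀ n, 0 < h n)
    (hO : (fun n : ℕ => (n : ℝ) ^ (-(1 / 7) : ℝ)) =O[atTop] h) :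
    Tendsto (fun n : ℕ => (n : ℝ) * h n ^ 3) atTop atTop := by
  obtain ⟨c, hc, hb⟩ := hO.exists_pos
  -- From `n^{-1/7} ≤ c h` follows `n h³ ≥ c⁻³ n^{1 - 3/7}`.
  have lim : Tendsto (fun n : ℕ => (c ^ 3)⁻¹ * (n : ℝ) ^ (4 / 7 : ℝ)) atTop atTop :=
    ((tendsto_rpow_atTop (by norm_num)).comp tendsto_natCast_atTop_atTop).const_mul_atTop
      (by positivity)
  refine tendsto_atTop_mono' _ ?_ lim
  filter_upwards [hb.bound, eventually_gt_atTop 0] with n hn hn0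
  have hnp : (0 : ℝ) < n := by positivity
  rw [Real.norm_of_nonneg (by positivity), Real.norm_of_nonneg (hpos n).le] at hn
  have e : (n : ℝ) ^ (4 / 7 : ℝ) = n * ((n : ℝ) ^ (-(1 / 7) : ℝ)) ^ 3 := by
    rw [← Real.rpow_natCast, ← Real.rpow_mul hnp.le]
    nth_rewrite 2 [← Real.rpow_one (n : ℝ)]
    rw [← Real.rpow_add hnp]
    norm_num
  rw [e, inv_mul_le_iff₀ (by positivity)]
  calc (n : ℝ) * ((n : ℝ) ^ (-(1 / 7) : ℝ)) ^ 3 ≤ n * (c * h n) ^ 3 := by gcongr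
    _ = _ := by ring

lemma rate_mul_sq_isBigO (hpos : ∀ n, 0 < h n)
    (hO : h =O[atTop] fun n : ℕ => (n : ℝ) ^ (-(1 / 7) : ℝ)) :
    (fun n => rate h n * h n ^ 2) =O[atTop] fun _ => (1 : ℝ) := by
  have h1 := (isBigO_refl (fun n : ℕ => (n : ℝ)) atTop).mul (hO.pow 7)
  refine IsBigO.of_pow (n := 2) two_ne_zero (h1.congr' ?_ ?_)
  · exact Eventually.of_forall fun n => (rate_mul_sq_sq hpos n).symm
  · filter_upwards [eventually_gt_atTop 0] with n hn
    simpa using natCast_mul_rpow_pow hn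

lemma tendsto_rate_mul_sq (hpos : ∀ n, 0 < h n)
    (ho : h =o[atTop] fun n : ℕ => (n : ℝ) ^ (-(1 / 7) : ℝ)) :
    Tendsto (fun n => rate h n * h n ^ 2) atTop (𝓝 0) := by
  have h1 := (isBigO_refl (fun n : ℕ => (n : ℝ)) atTop).mul_isLittleO (ho.pow (n := 7) (by simp))
  refine (isLittleO_one_iff ℝ).1 (IsLittleO.of_pow (n := 2) (h1.congr' ?_ ?_) two_ne_zero)
  · exact Eventually.of_forall fun n => (rate_mul_sq_sq hpos n).symm
  · filter_upwards [eventually_gt_atTop 0] with n hn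
    simpa using natCast_mul_rpow_pow hn

end Bandwidth

/-! ### The estimator with random weight. -/

section FinalEst

variable {Ω : Type*} {X T : ℕ → Ω → ℝ} {f q w : ℝ → ℝ} {x : ℝ} {h : ℕ → ℝ} {Fhat : ℕ → Ω → ℝ}

/-- The estimator is affine in its weight, with slope the contrast `f⁺ - f⁻`. The reference weight
`θ` is free: `0` serves for measurability and integrability, `F x` for the limits. -/
lemma finalEst_eq (θ : ℝ) (n : ℕ) (ω : Ω) :
    finalEst w q X T Fhat h x n ω = linEst w q X T h x (1 - θ) θ n ω
      + (Fhat n ω - θ) * linEst w q X T h x (-1) 1 n ω := by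
  simp only [finalEst, linEst]
  ring

variable [MeasurableSpace Ω] {P : Measure Ω}

lemma Model.measurable_finalEst (hM : Model P X T f q) (hw : IsKernel w)
    (hF : ∀ n, Measurable (Fhat n)) (n : ℕ) : Measurable (finalEst w q X T Fhat h x n) := by
  have : finalEst w q X T Fhat h x n = fun ω => _ := funext (finalEst_eq 0 n)
  rw [this]
  exact (hM.measurable_linEst hw _ _ n).add
    (((hF n).sub_const _).mul (hM.measurable_linEst hw _ _ n))

lemma HasLimitMSE.of_scaled {r : ℕ → ℝ} {θ v : ℝ} {e : ℕ → Ω → ℝ}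
    (he : ∀ᶠ n in atTop, MemLp (e n) 2 P)
    (h : Tendsto (fun n => ∫ ω, (r n * (e n ω - θ)) ^ 2 ∂P) atTop (𝓝 v)) :
    HasLimitMSE P r θ e v := by
  refine ⟨he, h.congr fun n => ?_⟩
  simp only [mul_pow, integral_const_mul]

/-- The optimal weight is `t = 1 - F x`. -/
lemma Model.asympVar_le_combVar (hM : Model P X T f q) (hx : x ∈ Set.Ioo (0 : ℝ) 1) (t : ℝ) :
    asympVar w f q x ≤ combVar w f q x t (1 - t) := by
  have h3 := (hM.q_pos x ⟨hx.1.le, hx.2.le⟩).le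
  have h4 : 0 ≤ ∫ u, deriv w u ^ 2 := integral_nonneg fun u => sq_nonneg _
  rw [asympVar, combVar]
  gcongr
  -- The difference `t² F + (1 - t)² (1 - F) - F (1 - F)` equals this square.
  nlinarith [sq_nonneg (t - (1 - distFun f x))]

variable [IsProbabilityMeasure P]

lemma Model.memLp_linEst (hM : Model P X T f q) (hw : IsKernel w) (hpos : ∀ n, 0 < h n)
    (h0 : Tendsto h atTop (𝓝 0)) (a b : ℝ) (p : ENNReal) :
    ∀ᶠ n in atTop, MemLp (linEst w q X T h x a b n) p P := by
  filter_upwards [hw.eventually_linEst_bounded (q := q) (X := X) (T := T) (x := x) hpos h0 a b]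
    with n ⟨C, hC⟩
  exact MemLp.of_bound (hM.measurable_linEst hw a b n).aestronglyMeasurable C (ae_of_all _ hC)

/-- For each large `n` the contrast is a bounded variable, so the product inherits square
integrability from `Fhat n`; the size of the bound plays no role. -/
lemma Model.memLp_remainder (hM : Model P X T f q) (hw : IsKernel w) (hpos : ∀ n, 0 < h n)
    (h0 : Tendsto h atTop (𝓝 0)) (hFL2 : ∀ᶠ n in atTop, MemLp (Fhat n) 2 P) (θ : ℝ) :
    ∀ᶠ n in atTop, MemLp (fun ω => (Fhat n ω - θ) * linEst w q X T h x (-1) 1 n ω) 2 P := by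
  filter_upwards
    [hw.eventually_linEst_bounded (q := q) (X := X) (T := T) (x := x) hpos h0 (-1) 1, hFL2]
    with n ⟨C, hC⟩ hF
  exact memLp_mul_of_abs_le (hF.sub (memLp_const θ)) (hM.measurable_linEst hw _ _ n) hC

lemma Model.memLp_finalEst (hM : Model P X T f q) (hw : IsKernel w) (hpos : ∀ n, 0 < h n)
    (h0 : Tendsto h atTop (𝓝 0)) (hFL2 : ∀ᶠ n in atTop, MemLp (Fhat n) 2 P) :
    ∀ᶠ n in atTop, MemLp (finalEst w q X T Fhat h x n) 2 P := by
  filter_upwards [hM.memLp_linEst (x := x) hw hpos h0 (1 - 0) 0 2,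
    hM.memLp_remainder (x := x) hw hpos h0 hFL2 0] with n h1 h2
  have : finalEst w q X T Fhat h x n = fun ω => _ := funext (finalEst_eq 0 n)
  rw [this]
  exact h1.add h2

/-- Second and fourth moments of the scaled contrast `f⁺ - f⁻` stay bounded. -/
lemma Model.exists_integral_contrast_le (hM : Model P X T f q)
    (hw : IsKernel w) (hx : x ∈ Set.Ioo (0 : ℝ) 1) (hf : ContDiffAt ℝ 2 f x)
    (hq : ContDiffAt ℝ 3 q x) (hpos : ∀ n, 0 < h n)
    (hO : h =O[atTop] fun n : ℕ => (n : ℝ) ^ (-(1 / 7) : ℝ))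
    (hn : Tendsto (fun n : ℕ => (n : ℝ) * h n ^ 3) atTop atTop) :
    ∃ C, 0 < C ∧ ∀ᶠ n in atTop,
      ∫ ω, (rate h n * linEst w q X T h x (-1) 1 n ω) ^ 2 ∂P ≤ C ∧
      ∫ ω, (rate h n * linEst w q X T h x (-1) 1 n ω) ^ 4 ∂P ≤ C := by
  have h0 := tendsto_bandwidth_zero hO
  set W : ℕ → Ω → ℝ := fun n ω => rate h n *
    (linEst w q X T h x (-1) 1 n ω - linMean P w q X T h x (-1) 1 n) with hW
  set c : ℕ → ℝ := fun n => rate h n * linMean P w q X T h x (-1) 1 n with hc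
  -- The weights `-1` and `1` cancel the target, so the scaled mean is `O(rate * h²)`, bounded by
  -- the choice of bandwidth.
  have hcO : c =O[atTop] fun _ => (1 : ℝ) := by
    have h1 := hM.linMean_sub_isBigO hw hx hf hq hpos h0 (-1) 1
    simp only [neg_add_cancel, zero_mul, sub_zero] at h1
    exact ((isBigO_refl (rate h) atTop).mul h1).trans (rate_mul_sq_isBigO hpos hO)
  obtain ⟨K, hK0, hK⟩ := hcO.exists_pos
  have l2 := hM.tendsto_integral_linEst_sq hw hx hf hq hpos h0 hn (-1) 1
  obtain ⟨C4, hC4⟩ := hM.exists_integral_linEst_pow_four_le hw hx hf hq hpos h0 hn (-1) 1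
  set C2 := combVar w f q x (-1) 1 + 1
  -- From `(u + v)² ≤ 2u² + 2v²` and `(u + v)⁴ ≤ 8u⁴ + 8v⁴`, for centred part plus mean; the `1`
  -- makes the constant positive.
  refine ⟨max 1 (max (2 * C2 + 2 * K ^ 2) (8 * C4 + 8 * K ^ 4)), by positivity, ?_⟩
  filter_upwards [hK.bound, hC4, l2.eventually_le_const (lt_add_one _),
    hw.eventually_linEst_bounded (q := q) (X := X) (T := T) (x := x) hpos h0 (-1) 1]
    with n hKn h4 h2 ⟨C, hC⟩
  have hDm := hM.measurable_linEst (h := h) (x := x) hw (-1) 1 n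
  have hiD (k : ℕ) : Integrable (fun ω => (rate h n * linEst w q X T h x (-1) 1 n ω) ^ k) P := by
    refine integrable_of_abs_le ((hDm.const_mul _).pow_const k)
      (C := (|rate h n| * C) ^ k) fun ω => ?_
    rw [abs_pow, abs_mul]
    have := hC ω
    gcongr
  have hWm : Measurable (W n) := (hDm.sub_const _).const_mul _
  have hiW (k : ℕ) : Integrable (fun ω => W n ω ^ k) P := by
    refine integrable_of_abs_le (hWm.pow_const k)
      (C := (|rate h n| * (C + |linMean P w q X T h x (-1) 1 n|)) ^ k) fun ω => ?_
    rw [abs_pow, hW, abs_mul]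
    have := (abs_sub (linEst w q X T h x (-1) 1 n ω) (linMean P w q X T h x (-1) 1 n)).trans
      (add_le_add_left (hC ω) _)
    gcongr
  have hdec (ω : Ω) : rate h n * linEst w q X T h x (-1) 1 n ω = W n ω + c n := by
    simp only [hW, hc]; ring
  have hcn : |c n| ≤ K := by simpa using hKn
  have hc2 : c n ^ 2 ≤ K ^ 2 := by rw [← sq_abs]; gcongr
  have hc4 : c n ^ 4 ≤ K ^ 4 := by
    calc c n ^ 4 = (c n ^ 2) ^ 2 := by ring
      _ ≤ (K ^ 2) ^ 2 := by gcongr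
      _ = K ^ 4 := by ring
  constructor
  · refine le_trans ?_ ((le_max_left _ _).trans (le_max_right _ _))
    calc _ ≤ ∫ ω, (2 * W n ω ^ 2 + 2 * c n ^ 2) ∂P := by
          refine integral_mono (hiD 2) (((hiW 2).const_mul 2).add (integrable_const _)) fun ω => ?_
          simp only [hdec]
          nlinarith [sq_nonneg (W n ω - c n)]
      _ = 2 * ∫ ω, W n ω ^ 2 ∂P + 2 * c n ^ 2 := by
          rw [integral_add ((hiW 2).const_mul 2) (integrable_const _), integral_const_mul]
          simp
      _ ≤ 2 * C2 + 2 * K ^ 2 := by gcongr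
  · refine le_trans ?_ ((le_max_right _ _).trans (le_max_right _ _))
    calc _ ≤ ∫ ω, (8 * W n ω ^ 4 + 8 * c n ^ 4) ∂P := by
          refine integral_mono (hiD 4) (((hiW 4).const_mul 8).add (integrable_const _)) fun ω => ?_
          simp only [hdec]
          have e1 : (W n ω + c n) ^ 2 ≤ 2 * W n ω ^ 2 + 2 * c n ^ 2 := by
            nlinarith [sq_nonneg (W n ω - c n)]
          calc (W n ω + c n) ^ 4 = ((W n ω + c n) ^ 2) ^ 2 := by ring
            _ ≤ (2 * W n ω ^ 2 + 2 * c n ^ 2) ^ 2 := by gcongr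
            _ ≤ 8 * W n ω ^ 4 + 8 * c n ^ 4 := by nlinarith [sq_nonneg (W n ω ^ 2 - c n ^ 2)]
      _ = 8 * ∫ ω, W n ω ^ 4 ∂P + 8 * c n ^ 4 := by
          rw [integral_add ((hiW 4).const_mul 8) (integrable_const _), integral_const_mul]
          simp
      _ ≤ 8 * C4 + 8 * K ^ 4 := by gcongr

/-- Cauchy–Schwarz with the rate given to the contrast, which is bounded in `L²` on that scale. No
independence of `Fhat` from the sample enters. -/
lemma integral_abs_rate_mul_remainder_le (hM : Model P X T f q) (hw : IsKernel w)
    (hpos : ∀ n, 0 < h n) (h0 : Tendsto h atTop (𝓝 0))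
    (hFL2 : ∀ᶠ n in atTop, MemLp (Fhat n) 2 P) (θ : ℝ) :
    ∀ᶠ n in atTop,
      ∫ ω, |rate h n * ((Fhat n ω - θ) * linEst w q X T h x (-1) 1 n ω)| ∂P
        ≤ √(∫ ω, (Fhat n ω - θ) ^ 2 ∂P)
          * √(∫ ω, (rate h n * linEst w q X T h x (-1) 1 n ω) ^ 2 ∂P) := by
  filter_upwards [hFL2, hM.memLp_linEst (x := x) hw hpos h0 (-1) 1 2] with n hF hD
  have h1 := integral_abs_mul_le_sqrt (hF.sub (memLp_const θ)) (hD.const_mul (rate h n))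
  refine le_of_eq_of_le ?_ h1
  congr 1 with ω
  simp only [Pi.sub_apply]
  congr 1
  ring

lemma tendsto_integral_abs_rate_mul_remainder (hM : Model P X T f q)
    (hw : IsKernel w) (hx : x ∈ Set.Ioo (0 : ℝ) 1) (hf : ContDiffAt ℝ 2 f x)
    (hq : ContDiffAt ℝ 3 q x) (hpos : ∀ n, 0 < h n)
    (hO : h =O[atTop] fun n : ℕ => (n : ℝ) ^ (-(1 / 7) : ℝ))
    (hn : Tendsto (fun n : ℕ => (n : ℝ) * h n ^ 3) atTop atTop)
    (hFL2 : ∀ᶠ n in atTop, MemLp (Fhat n) 2 P) {θ : ℝ}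
    (hFcons : Tendsto (fun n => ∫ ω, (Fhat n ω - θ) ^ 2 ∂P) atTop (𝓝 0)) :
    Tendsto (fun n => ∫ ω, |rate h n * ((Fhat n ω - θ) * linEst w q X T h x (-1) 1 n ω)| ∂P)
      atTop (𝓝 0) := by
  obtain ⟨C, hC0, hC⟩ := hM.exists_integral_contrast_le hw hx hf hq hpos hO hn
  have lim : Tendsto (fun n => √(∫ ω, (Fhat n ω - θ) ^ 2 ∂P) * √C) atTop (𝓝 0) := by
    simpa using hFcons.sqrt.mul_const (√C)
  refine squeeze_zero' (Eventually.of_forall fun n => integral_nonneg fun ω => abs_nonneg _) ?_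
      lim
  filter_upwards [integral_abs_rate_mul_remainder_le hM hw hpos (tendsto_bandwidth_zero hO) hFL2 θ,
    hC] with n h1 h2
  refine h1.trans ?_
  gcongr
  exact h2.1

lemma Model.integral_finalEst (hM : Model P X T f q) (hw : IsKernel w) (hpos : ∀ n, 0 < h n)
    (h0 : Tendsto h atTop (𝓝 0)) (hFL2 : ∀ᶠ n in atTop, MemLp (Fhat n) 2 P) (θ : ℝ) :
    ∀ᶠ n in atTop, ∫ ω, finalEst w q X T Fhat h x n ω ∂P = linMean P w q X T h x (1 - θ) θ n
      + ∫ ω, (Fhat n ω - θ) * linEst w q X T h x (-1) 1 n ω ∂P := by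
  filter_upwards [hM.memLp_linEst (x := x) hw hpos h0 (1 - θ) θ 1,
    hM.memLp_remainder (x := x) hw hpos h0 hFL2 θ,
    hM.integral_linEst (x := x) hw (1 - θ) θ hpos h0] with n h1 h2 h3
  simp only [finalEst_eq θ]
  rw [integral_add (h1.integrable le_rfl) (h2.integrable (by norm_num)), h3]

/-- Asymptotic normality of the final estimator around its expectation. -/
lemma Model.tendstoNormal_finalEst_centered (hM : Model P X T f q)
    (hw : IsKernel w) (hx : x ∈ Set.Ioo (0 : ℝ) 1) (hf : ContDiffAt ℝ 2 f x)
    (hq : ContDiffAt ℝ 3 q x) (hpos : ∀ n, 0 < h n)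
    (hO : h =O[atTop] fun n : ℕ => (n : ℝ) ^ (-(1 / 7) : ℝ))
    (hn : Tendsto (fun n : ℕ => (n : ℝ) * h n ^ 3) atTop atTop)
    (hFmeas : ∀ n, Measurable (Fhat n))
    (hFL2 : ∀ᶠ n in atTop, MemLp (Fhat n) 2 P) {θ : ℝ}
    (hFcons : Tendsto (fun n => ∫ ω, (Fhat n ω - θ) ^ 2 ∂P) atTop (𝓝 0)) :
    TendstoNormal P (fun n ω => rate h n *
      (finalEst w q X T Fhat h x n ω - ∫ ω', finalEst w q X T Fhat h x n ω' ∂P))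
      (combVar w f q x (1 - θ) θ) := by
  have h0 := tendsto_bandwidth_zero hO
  have hR := tendsto_integral_abs_rate_mul_remainder hM hw hx hf hq hpos hO hn hFL2 hFcons
  set R : ℕ → Ω → ℝ := fun n ω =>
    rate h n * ((Fhat n ω - θ) * linEst w q X T h x (-1) 1 n ω) with hRdef
  have hRi : ∀ᶠ n in atTop, Integrable (R n) P :=
    (hM.memLp_remainder hw hpos h0 hFL2 θ).mono fun n hn =>
      (hn.integrable (by norm_num)).const_mul _
  -- Centring the final estimator replaces the remainder by its centred version, whose `L¹` norm is
  -- at most twice that of `R n`.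
  have hdiff : ∀ᶠ n in atTop, ∀ ω, rate h n *
      (finalEst w q X T Fhat h x n ω - ∫ ω', finalEst w q X T Fhat h x n ω' ∂P)
      - rate h n * (linEst w q X T h x (1 - θ) θ n ω - linMean P w q X T h x (1 - θ) θ n)
      = R n ω - ∫ ω', R n ω' ∂P := by
    filter_upwards [hM.integral_finalEst (x := x) hw hpos h0 hFL2 θ] with n hn ω
    rw [hn, finalEst_eq θ n ω]
    simp only [hRdef, integral_const_mul]
    ring
  refine (hM.tendstoNormal_linEst hw hx hf hq hpos h0 hn (1 - θ) θ).of_integral_abs_sub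
    (fun n => ((hM.measurable_linEst hw _ _ n).sub_const _).const_mul _)
    (fun n => ((hM.measurable_finalEst hw hFmeas n).sub_const _).const_mul _) ?_ ?_
  · filter_upwards [hdiff, hRi] with n hn hRn
    simp only [hn]
    exact hRn.sub (integrable_const _)
  · have lim : Tendsto (fun n => 2 * ∫ ω, |R n ω| ∂P) atTop (𝓝 0) := by
      rw [← mul_zero (2 : ℝ)]
      exact hR.const_mul 2
    refine squeeze_zero' (Eventually.of_forall fun n => integral_nonneg fun ω => abs_nonneg _) ?_
      lim
    filter_upwards [hdiff, hRi] with n hn hRn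
    simp only [hn]
    calc _ ≤ ∫ ω, (|R n ω| + |∫ ω', R n ω' ∂P|) ∂P :=
          integral_mono (hRn.sub (integrable_const _)).abs (hRn.abs.add (integrable_const _))
            fun ω => abs_sub _ _
      _ = (∫ ω, |R n ω| ∂P) + |∫ ω', R n ω' ∂P| := by
          rw [integral_add hRn.abs (integrable_const _)]; simp
      _ ≤ 2 * ∫ ω, |R n ω| ∂P := by
          have : |∫ ω', R n ω' ∂P| ≤ ∫ ω, |R n ω| ∂P := abs_integral_le_integral_abs
          linarith

/-- The plug-in error in the mean of the final estimator is of smaller order than `h²`. -/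
lemma Model.isLittleO_integral_remainder (hM : Model P X T f q)
    (hw : IsKernel w) (hx : x ∈ Set.Ioo (0 : ℝ) 1) (hf : ContDiffAt ℝ 2 f x)
    (hq : ContDiffAt ℝ 3 q x) (hpos : ∀ n, 0 < h n)
    (hO : h =O[atTop] fun n : ℕ => (n : ℝ) ^ (-(1 / 7) : ℝ))
    (hn : Tendsto (fun n : ℕ => (n : ℝ) * h n ^ 3) atTop atTop)
    (hFL2 : ∀ᶠ n in atTop, MemLp (Fhat n) 2 P) {θ : ℝ}
    (hFo : (fun n => ∫ ω, (Fhat n ω - θ) ^ 2 ∂P) =o[atTop] fun n : ℕ => (n : ℝ) * h n ^ 7) :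
    (fun n => ∫ ω, (Fhat n ω - θ) * linEst w q X T h x (-1) 1 n ω ∂P)
      =o[atTop] fun n => h n ^ 2 := by
  have h0 := tendsto_bandwidth_zero hO
  obtain ⟨C, hC0, hC⟩ := hM.exists_integral_contrast_le hw hx hf hq hpos hO hn
  refine isLittleO_iff.2 fun c hc => ?_
  -- The tolerance `c² / C` is chosen so that `√(c² / C * n h⁷) * √C = rate * (c * h²)`; the rate
  -- then cancels.
  have hFc := isLittleO_iff.1 hFo (show 0 < c ^ 2 / C by positivity)
  filter_upwards [hFc, hC, integral_abs_rate_mul_remainder_le hM hw hpos h0 hFL2 θ,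
    eventually_gt_atTop 0] with n h1 h2 h3 hn0
  have hp := hpos n
  have hnp : (0 : ℝ) < n := by positivity
  have hrate : 0 < rate h n := Real.sqrt_pos.2 (mul_pos hnp (pow_pos hp 3))
  have hE0 : 0 ≤ ∫ ω, (Fhat n ω - θ) ^ 2 ∂P := integral_nonneg fun ω => sq_nonneg _
  rw [Real.norm_of_nonneg hE0, Real.norm_of_nonneg (by positivity)] at h1
  rw [Real.norm_of_nonneg (by positivity : 0 ≤ h n ^ 2), Real.norm_eq_abs]
  have h4 : rate h n * |∫ ω, (Fhat n ω - θ) * linEst w q X T h x (-1) 1 n ω ∂P|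
      ≤ rate h n * (c * h n ^ 2) := by
    calc _ = |∫ ω, rate h n * ((Fhat n ω - θ) * linEst w q X T h x (-1) 1 n ω) ∂P| := by
          rw [integral_const_mul, abs_mul, abs_of_pos hrate]
      _ ≤ _ := abs_integral_le_integral_abs
      _ ≤ _ := h3
      _ ≤ √(c ^ 2 / C * (n * h n ^ 7)) * √C := by gcongr; exact h2.1
      _ = √((rate h n * (c * h n ^ 2)) ^ 2) := by
          rw [← Real.sqrt_mul (by positivity)]
          congr 1
          rw [mul_pow, rate_sq hpos]
          field_simp
      _ = _ := Real.sqrt_sq (by positivity)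
  exact le_of_mul_le_mul_left h4 hrate

lemma Model.tendsto_rate_mul_bias (hM : Model P X T f q)
    (hw : IsKernel w) (hx : x ∈ Set.Ioo (0 : ℝ) 1) (hf : ContDiffAt ℝ 2 f x)
    (hq : ContDiffAt ℝ 3 q x) (hpos : ∀ n, 0 < h n) (h0 : Tendsto h atTop (𝓝 0))
    (ho : h =o[atTop] fun n : ℕ => (n : ℝ) ^ (-(1 / 7) : ℝ)) {a b : ℝ} (hab : a + b = 1) :
    Tendsto (fun n => rate h n * (linMean P w q X T h x a b n - f x)) atTop (𝓝 0) := by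
  have h1 := hM.linMean_sub_isBigO hw hx hf hq hpos h0 a b
  rw [hab, one_mul] at h1
  exact ((isBigO_refl (rate h) atTop).mul h1).trans_tendsto (tendsto_rate_mul_sq hpos ho)

/-- With undersmoothing, `a f⁻ + b f⁺`, `a + b = 1`, is asymptotically normal around `f x`. -/
lemma Model.tendstoNormal_linEst_sub (hM : Model P X T f q)
    (hw : IsKernel w) (hx : x ∈ Set.Ioo (0 : ℝ) 1) (hf : ContDiffAt ℝ 2 f x)
    (hq : ContDiffAt ℝ 3 q x) (hpos : ∀ n, 0 < h n) (h0 : Tendsto h atTop (𝓝 0))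
    (hn : Tendsto (fun n : ℕ => (n : ℝ) * h n ^ 3) atTop atTop)
    (ho : h =o[atTop] fun n : ℕ => (n : ℝ) ^ (-(1 / 7) : ℝ)) {a b : ℝ} (hab : a + b = 1) :
    TendstoNormal P (fun n ω => rate h n * (linEst w q X T h x a b n ω - f x))
      (combVar w f q x a b) := by
  have hd (n : ℕ) (ω : Ω) : rate h n * (linEst w q X T h x a b n ω - f x)
      - rate h n * (linEst w q X T h x a b n ω - linMean P w q X T h x a b n)
      = rate h n * (linMean P w q X T h x a b n - f x) := by ring
  refine (hM.tendstoNormal_linEst hw hx hf hq hpos h0 hn a b).of_integral_abs_sub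
    (fun n => ((hM.measurable_linEst hw _ _ n).sub_const _).const_mul _)
    (fun n => ((hM.measurable_linEst hw _ _ n).sub_const _).const_mul _) ?_ ?_
  · simp only [hd]
    exact Eventually.of_forall fun n => integrable_const _
  · simp only [hd, integral_const, probReal_univ, one_smul]
    simpa using (hM.tendsto_rate_mul_bias hw hx hf hq hpos h0 ho hab).abs

lemma Model.tendstoNormal_finalEst_sub (hM : Model P X T f q)
    (hw : IsKernel w) (hx : x ∈ Set.Ioo (0 : ℝ) 1) (hf : ContDiffAt ℝ 2 f x)
    (hq : ContDiffAt ℝ 3 q x) (hpos : ∀ n, 0 < h n)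
    (hO : h =O[atTop] fun n : ℕ => (n : ℝ) ^ (-(1 / 7) : ℝ))
    (hn : Tendsto (fun n : ℕ => (n : ℝ) * h n ^ 3) atTop atTop)
    (ho : h =o[atTop] fun n : ℕ => (n : ℝ) ^ (-(1 / 7) : ℝ))
    (hFmeas : ∀ n, Measurable (Fhat n))
    (hFL2 : ∀ᶠ n in atTop, MemLp (Fhat n) 2 P) {θ : ℝ}
    (hFcons : Tendsto (fun n => ∫ ω, (Fhat n ω - θ) ^ 2 ∂P) atTop (𝓝 0)) :
    TendstoNormal P (fun n ω => rate h n * (finalEst w q X T Fhat h x n ω - f x))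
      (combVar w f q x (1 - θ) θ) := by
  have h0 := tendsto_bandwidth_zero hO
  have hd (n : ℕ) (ω : Ω) : rate h n * (finalEst w q X T Fhat h x n ω - f x)
      - rate h n * (linEst w q X T h x (1 - θ) θ n ω - f x)
      = rate h n * ((Fhat n ω - θ) * linEst w q X T h x (-1) 1 n ω) := by
    rw [finalEst_eq θ]; ring
  refine (hM.tendstoNormal_linEst_sub hw hx hf hq hpos h0 hn ho
    (sub_add_cancel 1 θ)).of_integral_abs_sub
    (fun n => ((hM.measurable_linEst hw _ _ n).sub_const _).const_mul _)
    (fun n => ((hM.measurable_finalEst hw hFmeas n).sub_const _).const_mul _) ?_ ?_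
  · simp only [hd]
    exact (hM.memLp_remainder hw hpos h0 hFL2 θ).mono fun n hn =>
      (hn.integrable (by norm_num)).const_mul _
  · simp only [hd]
    exact tendsto_integral_abs_rate_mul_remainder hM hw hx hf hq hpos hO hn hFL2 hFcons

lemma Model.tendsto_integral_linEst_sub_sq (hM : Model P X T f q)
    (hw : IsKernel w) (hx : x ∈ Set.Ioo (0 : ℝ) 1) (hf : ContDiffAt ℝ 2 f x)
    (hq : ContDiffAt ℝ 3 q x) (hpos : ∀ n, 0 < h n) (h0 : Tendsto h atTop (𝓝 0))
    (hn : Tendsto (fun n : ℕ => (n : ℝ) * h n ^ 3) atTop atTop)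
    (ho : h =o[atTop] fun n : ℕ => (n : ℝ) ^ (-(1 / 7) : ℝ)) {a b : ℝ} (hab : a + b = 1) :
    Tendsto (fun n => ∫ ω, (rate h n * (linEst w q X T h x a b n ω - f x)) ^ 2 ∂P) atTop
      (𝓝 (combVar w f q x a b)) := by
  -- The bias is treated as a deterministic perturbation vanishing in mean square.
  have hb : Tendsto (fun n => ∫ _ω, (rate h n * (linMean P w q X T h x a b n - f x)) ^ 2 ∂P)
      atTop (𝓝 0) := by
    simpa using (hM.tendsto_rate_mul_bias hw hx hf hq hpos h0 ho hab).pow 2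
  have hA : ∀ᶠ n in atTop, MemLp (fun ω => rate h n *
      (linEst w q X T h x a b n ω - linMean P w q X T h x a b n)) 2 P :=
    (hM.memLp_linEst hw hpos h0 a b 2).mono fun n hn => (hn.sub (memLp_const _)).const_mul _
  refine (tendsto_integral_add_sq hA (Eventually.of_forall fun n => memLp_const _)
    (hM.tendsto_integral_linEst_sq hw hx hf hq hpos h0 hn a b) hb).congr fun n => ?_
  congr 1 with ω
  ring

/-- Mean square convergence for the final estimator under a fourth moment condition. -/
lemma Model.tendsto_integral_finalEst_sub_sq (hM : Model P X T f q)
    (hw : IsKernel w) (hx : x ∈ Set.Ioo (0 : ℝ) 1) (hf : ContDiffAt ℝ 2 f x)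
    (hq : ContDiffAt ℝ 3 q x) (hpos : ∀ n, 0 < h n)
    (hO : h =O[atTop] fun n : ℕ => (n : ℝ) ^ (-(1 / 7) : ℝ))
    (hn : Tendsto (fun n : ℕ => (n : ℝ) * h n ^ 3) atTop atTop)
    (ho : h =o[atTop] fun n : ℕ => (n : ℝ) ^ (-(1 / 7) : ℝ))
    (hFL2 : ∀ᶠ n in atTop, MemLp (Fhat n) 2 P)
    (hFL4 : ∀ᶠ n in atTop, MemLp (Fhat n) 4 P) {θ : ℝ}
    (hFcons4 : Tendsto (fun n => ∫ ω, (Fhat n ω - θ) ^ 4 ∂P) atTop (𝓝 0)) :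
    Tendsto (fun n => ∫ ω, (rate h n * (finalEst w q X T Fhat h x n ω - f x)) ^ 2 ∂P) atTop
      (𝓝 (combVar w f q x (1 - θ) θ)) := by
  have h0 := tendsto_bandwidth_zero hO
  have hA : ∀ᶠ n in atTop, MemLp (fun ω => rate h n *
      (linEst w q X T h x (1 - θ) θ n ω - f x)) 2 P :=
    (hM.memLp_linEst hw hpos h0 _ _ 2).mono fun n hn => (hn.sub (memLp_const _)).const_mul _
  have hB : ∀ᶠ n in atTop, MemLp (fun ω => rate h n *
      ((Fhat n ω - θ) * linEst w q X T h x (-1) 1 n ω)) 2 P :=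
    (hM.memLp_remainder hw hpos h0 hFL2 θ).mono fun n hn => hn.const_mul _
  obtain ⟨C, hC0, hC⟩ := hM.exists_integral_contrast_le hw hx hf hq hpos hO hn
  -- Cauchy–Schwarz applied to the squares of both factors; this is where fourth moments of `Fhat`
  -- and of the contrast are required.
  have hB0 : Tendsto (fun n => ∫ ω, (rate h n *
      ((Fhat n ω - θ) * linEst w q X T h x (-1) 1 n ω)) ^ 2 ∂P) atTop (𝓝 0) := by
    have lim : Tendsto (fun n => √(∫ ω, (Fhat n ω - θ) ^ 4 ∂P) * √C) atTop (𝓝 0) := by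
      simpa using hFcons4.sqrt.mul_const (√C)
    refine squeeze_zero' (Eventually.of_forall fun n => integral_nonneg fun ω => sq_nonneg _) ?_
      lim
    filter_upwards [hFL4, hC, hM.memLp_linEst (x := x) hw hpos h0 (-1) 1 4] with n hF hCn hD
    have sq_memLp {A : Ω → ℝ} (hA : MemLp A 4 P) : MemLp (fun ω => A ω ^ 2) 2 P := by
      have := hA.norm_rpow_div 2
      have e : (4 : ENNReal) / 2 = 2 := by
        rw [show (4 : ENNReal) = 2 * 2 by norm_num,
          ENNReal.mul_div_cancel_right (by norm_num) (by norm_num)]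
      simpa [e] using this
    have h1 := integral_abs_mul_le_sqrt (sq_memLp (hF.sub (memLp_const θ)))
      (sq_memLp (hD.const_mul (rate h n)))
    have e (a b : ℝ) : |a ^ 2 * b ^ 2| = a ^ 2 * b ^ 2 := abs_of_nonneg (by positivity)
    simp only [Pi.sub_apply, ← pow_mul, Nat.reduceMul, e] at h1
    calc _ = ∫ ω, (Fhat n ω - θ) ^ 2 * (rate h n * linEst w q X T h x (-1) 1 n ω) ^ 2 ∂P := by
          congr 1 with ω; ring
      _ ≤ _ := h1
      _ ≤ √(∫ ω, (Fhat n ω - θ) ^ 4 ∂P) * √C := by gcongr; exact hCn.2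
  refine (tendsto_integral_add_sq hA hB (hM.tendsto_integral_linEst_sub_sq hw hx hf hq hpos h0 hn
    ho (sub_add_cancel 1 θ)) hB0).congr fun n => ?_
  congr 1 with ω
  rw [finalEst_eq θ]
  ring

lemma asympVar_eq : asympVar w f q x = combVar w f q x (1 - distFun f x) (distFun f x) := by
  rw [asympVar, combVar]; ring

lemma Model.asympVar_nonneg (hM : Model P X T f q) (hx : x ∈ Set.Ioo (0 : ℝ) 1) :
    0 ≤ asympVar w f q x := by
  have h1 := hM.distFun_nonneg x
  have h2 : 0 ≤ 1 - distFun f x := by linarith [hM.distFun_le_one x]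
  have h3 := (hM.q_pos x ⟨hx.1.le, hx.2.le⟩).le
  have h4 : 0 ≤ ∫ u, deriv w u ^ 2 := integral_nonneg fun u => sq_nonneg _
  rw [asympVar]
  positivity

/-- The optimality criterion, for any error criterion under which the final estimator and the fixed
weight combinations have the asymptotic variances as errors. -/
lemma Model.isTOptimal (hM : Model P X T f q) (hx : x ∈ Set.Ioo (0 : ℝ) 1)
    {crit : (ℕ → Ω → ℝ) → ℝ → Prop} {e : ℕ → Ω → ℝ} (he : crit e (asympVar w f q x))
    (hfam : ∀ t, crit (combEst w q X T h x t) (combVar w f q x t (1 - t))) :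
    IsTOptimal crit (combEst w q X T h x) e := by
  -- The minimum is attained at `t = 1 - F x`, which lies in `[0, 1]` as `F` is a distribution
  -- function.
  refine ⟨asympVar w f q x, he, ⟨1 - distFun f x, ⟨?_, ?_⟩, ?_⟩, fun t _ =>
    ⟨_, hfam t, hM.asympVar_le_combVar hx t⟩⟩
  · linarith [hM.distFun_le_one x]
  · linarith [hM.distFun_nonneg x]
  · have := hfam (1 - distFun f x)
    rwa [sub_sub_cancel, ← asympVar_eq] at this

end FinalEst

end CurrentStatus

/-! ### The main theorem. -/

open CurrentStatus in
theorem mainTheorem1 {Ω : Type*} [MeasurableSpace Ω] (P : Measure Ω) [IsProbabilityMeasure P]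
    (X T : ℕ → Ω → ℝ) (f q w : ℝ → ℝ) (hmodel : Model P X T f q) (hw : IsKernel w)
    (x : ℝ) (hx : x ∈ Set.Ioo (0 : ℝ) 1)
    (hf : ContDiffAt ℝ 2 f x) (hq : ContDiffAt ℝ 3 q x)
    (Fhat : ℕ → Ω → ℝ) (hFmeas : ∀ n, Measurable (Fhat n))
    (hFL2 : ∀ᶠ n in atTop, MemLp (Fhat n) 2 P)
    (hFcons : Tendsto (fun n => ∫ ω, (Fhat n ω - distFun f x) ^ 2 ∂P) atTop (𝓝 0))
    (h : ℕ → ℝ) (hpos : ∀ n, 0 < h n)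
    (hO : h =O[atTop] fun n : ℕ => (n : ℝ) ^ (-(1 / 7) : ℝ)) :
    -- the bandwidth tends to zero, and `n h³ → ∞` if `h` is of exact order `n^{-1/7}`
    Tendsto h atTop (𝓝 0) ∧
    (((fun n : ℕ => (n : ℝ) ^ (-(1 / 7) : ℝ)) =O[atTop] h) →
      Tendsto (fun n : ℕ => (n : ℝ) * h n ^ 3) atTop atTop) ∧
    (Tendsto (fun n : ℕ => (n : ℝ) * h n ^ 3) atTop atTop →
      -- the expectation of the final estimator exists for large `n`
      (∀ᶠ n in atTop, Integrable (finalEst w q X T Fhat h x n) P) ∧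
      -- asymptotic normality around the expectation
      TendstoNormal P
        (fun n ω => rate h n *
          (finalEst w q X T Fhat h x n ω - ∫ ω', finalEst w q X T Fhat h x n ω' ∂P))
        (asympVar w f q x) ∧
      -- expansion of the bias
      (((fun n => ∫ ω, (Fhat n ω - distFun f x) ^ 2 ∂P)
          =o[atTop] fun n : ℕ => (n : ℝ) * h n ^ 7) →
        (fun n => (∫ ω, finalEst w q X T Fhat h x n ω ∂P) -
            (f x + 1 / 2 * h n ^ 2 * (∫ v, v ^ 2 * w v) *
              ((1 - distFun f x) * bLeft f q x + distFun f x * bRight f q x)))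
          =o[atTop] fun n => h n ^ 2) ∧
      -- bandwidths of smaller order than `n^{-1/7}`
      ((h =o[atTop] fun n : ℕ => (n : ℝ) ^ (-(1 / 7) : ℝ)) →
        IsTOptimal (HasAsympMSE P (rate h) (f x)) (combEst w q X T h x)
          (finalEst w q X T Fhat h x) ∧
        TendstoNormal P (fun n ω => rate h n * (finalEst w q X T Fhat h x n ω - f x))
          (asympVar w f q x) ∧
        -- optimality for the limit of the mean squared error itself
        ((∀ᶠ n in atTop, MemLp (Fhat n) 4 P) →
          Tendsto (fun n => ∫ ω, (Fhat n ω - distFun f x) ^ 4 ∂P) atTop (𝓝 0) →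
          IsTOptimal (HasLimitMSE P (rate h) (f x)) (combEst w q X T h x)
              (finalEst w q X T Fhat h x) ∧
            HasLimitMSE P (rate h) (f x) (finalEst w q X T Fhat h x) (asympVar w f q x)))) := by
  have h0 := tendsto_bandwidth_zero hO
  refine ⟨h0, tendsto_mul_cube_atTop hpos, fun hn => ⟨?_, ?_, fun hFo => ?_, fun ho => ?_⟩⟩
  · exact (hmodel.memLp_finalEst hw hpos h0 hFL2).mono fun n hn => hn.integrable (by norm_num)
  · rw [asympVar_eq]
    exact hmodel.tendstoNormal_finalEst_centered hw hx hf hq hpos hO hn hFmeas hFL2 hFcons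
  · have h1 := hmodel.isLittleO_linMean hw hx hf hq hpos h0 (1 - distFun f x) (distFun f x)
    have h2 := hmodel.isLittleO_integral_remainder hw hx hf hq hpos hO hn hFL2 hFo
    refine (h1.add h2).congr' ?_ EventuallyEq.rfl
    filter_upwards [hmodel.integral_finalEst hw hpos h0 hFL2 (distFun f x)] with n hn
    rw [hn]
    ring
  · have hfinal := hmodel.tendstoNormal_finalEst_sub hw hx hf hq hpos hO hn ho hFmeas hFL2 hFcons
    rw [← asympVar_eq] at hfinal
    have hv0 := hmodel.asympVar_nonneg (w := w) hx
    have hsum (t : ℝ) : t + (1 - t) = 1 := add_sub_cancel t 1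
    refine ⟨?_, hfinal, fun hFL4 hFcons4 => ?_⟩
    · exact hmodel.isTOptimal hx (hfinal.hasAsympMSE hv0) fun t =>
        (hmodel.tendstoNormal_linEst_sub hw hx hf hq hpos h0 hn ho (hsum t)).hasAsympMSE
          -- Each member's limit variance is nonnegative because it dominates `asympVar`.
          (hv0.trans (hmodel.asympVar_le_combVar hx t))
    · have hlim : HasLimitMSE P (rate h) (f x) (finalEst w q X T Fhat h x) (asympVar w f q x) := by
        rw [asympVar_eq]
        exact HasLimitMSE.of_scaled (hmodel.memLp_finalEst hw hpos h0 hFL2)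
          (hmodel.tendsto_integral_finalEst_sub_sq hw hx hf hq hpos hO hn ho hFL2 hFL4 hFcons4)
      exact ⟨hmodel.isTOptimal hx hlim fun t =>
        HasLimitMSE.of_scaled (hmodel.memLp_linEst hw hpos h0 t (1 - t) 2)
          (hmodel.tendsto_integral_linEst_sub_sq hw hx hf hq hpos h0 hn ho (hsum t)), hlim⟩
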